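/- Let $0<s<1$, and put $\nu=\frac{1-s^2}{2s}$ and $\alpha=\frac{1+s^2}{4s}$. Let $d\lambda$ be Lebesgue measure on $\mathbb C$, let $\partial_z=\frac12(\partial_x-i\partial_y)$ and $\partial_{\bar z}=\frac12(\partial_x+i\partial_y)$, and let $\mathscr H^{2,s}(\mathbb C)=L^2(\mathbb C,\omega_s\,d\lambda)$ with $\omega_s(z)=e^{\alpha(z^2+\bar z^2)-\nu|z|^2}$. Let $\mathcal X_s(\mathbb C)$ be the space of entire functions belonging to $\mathscr H^{2,s}(\mathbb C)$. For $n=0,1,2,\dots$ let $\mathcal F^{2,\nu}_n(\mathbb C)$ be the space of functions $g\in C^2(\mathbb C)\cap L^2(\mathbb C,e^{-\nu|z|^2}d\lambda)$ with $\Delta_\nu g=n\nu g$, where $\Delta_\nu=-\partial_z\partial_{\bar z}+\nu\bar z\,\partial_{\bar z}$, and let $$\mathcal X_{n,s}(\mathbb C)=\{e^{-\alpha z^2}g : g\in\mathcal F^{2,\nu}_n(\mathbb C)\}.$$ These spaces are regarded as subspaces of $\mathscr H^{2,s}(\mathbb C)$, with the inner product of $\mathscr H^{2,s}(\mathbb C)$.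 Let $$[\mathscr W^s_n f](z)=\frac{\nu}{\pi}\Big(\frac{\nu^n}{n!}\Big)^{1/2}e^{-\alpha z^2}\int_{\mathbb C}e^{-\nu|\xi|^2+\alpha\xi^2+\nu\bar\xi z}\,(\bar z-\bar\xi)^n f(\xi)\,d\lambda(\xi).$$ Let $H_m(z)=m!\sum_{k=0}^{\lfloor m/2\rfloor}\frac{(-1)^k}{k!}\frac{(2z)^{m-2k}}{(m-2k)!}$ be the holomorphic Hermite polynomials, let $\nabla_{\nu,a}=-\partial_z+\nu\bar z-2az$ for $a\in\mathbb R$, and let $$\psi^s_{m,n}(z)=\Big(\frac{1-s}{\pi\nu^n n!\sqrt s}\Big)^{1/2}\Big(\frac{1-s}{1+s}\Big)^{m/2}\frac{e^{-z^2/2}}{\sqrt{2^m m!}}\,\big(\nabla^n_{\nu,\alpha-\frac12}H_m\big)(z),\qquad m,n=0,1,2,\dots$$ Theorem. (1) For every $n\ge 0$, the integral defining $\mathscr W^s_n f(z)$ converges absolutely for all $f\in\mathcal X_s(\mathbb C)$ and $z\in\mathbb C$, and $\mathscr W^s_n$ is a unitary operator from $\mathcal X_s(\mathbb C)$ onto $\mathcal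 X_{n,s}(\mathbb C)$. (2) For every $n\ge 0$, the functions $\psi^s_{m,n}$, $m=0,1,2,\dots$, form an orthonormal basis of the Hilbert space $\mathcal X_{n,s}(\mathbb C)$. (3) The space $\mathscr H^{2,s}(\mathbb C)$ is the orthogonal Hilbert sum $\mathscr H^{2,s}(\mathbb C)=\bigoplus_{n=0}^\infty\mathcal X_{n,s}(\mathbb C)$. -/

import Mathlib

open MeasureTheory Complex
open scoped ComplexConjugate ENNReal

noncomputable section

namespace HolHermite

/-- The parameter `ν = (1 - s²) / (2s)`. -/
def nu (s : ℝ) : ℝ := (1 - s ^ 2) / (2 * s)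

/-- The parameter `α = (1 + s²) / (4s)`. -/
def alpha (s : ℝ) : ℝ := (1 + s ^ 2) / (4 * s)

/-- The weight `ω_s(z) = exp (α (z² + z̄²) - ν |z|²)`; the exponent is real. -/
def omega (s : ℝ) (z : ℂ) : ℝ :=
  Real.exp (alpha s * (z ^ 2 + conj z ^ 2).re - nu s * ‖z‖ ^ 2)

/-- The measure `ω_s dλ`. The space `ℋ^{2,s}(ℂ) = L²(ℂ, ω_s dλ)` is `Lp ℂ 2 (muS s)`. -/
def muS (s : ℝ) : Measure ℂ :=
  (volume : Measure ℂ).withDensity fun z => ENNReal.ofReal (omega s z)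

/-- The Gaussian measure `exp (-ν |z|²) dλ`. -/
def fockMeasure (ν : ℝ) : Measure ℂ :=
  (volume : Measure ℂ).withDensity fun z => ENNReal.ofReal (Real.exp (-ν * ‖z‖ ^ 2))

/-- The Wirtinger derivative `∂_z = (∂_x - i ∂_y) / 2`. -/
def dz (f : ℂ → ℂ) (z : ℂ) : ℂ := (fderiv ℝ f z 1 - I * fderiv ℝ f z I) / 2

/-- The Wirtinger derivative `∂_{z̄} = (∂_x + i ∂_y) / 2`. -/
def dzbar (f : ℂ → ℂ) (z : ℂ) : ℂ := (fderiv ℝ f z 1 + I * fderiv ℝ f z I) / 2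

/-- The magnetic Laplacian `Δ_ν = -∂_z ∂_{z̄} + ν z̄ ∂_{z̄}`. -/
def magLaplacian (ν : ℝ) (f : ℂ → ℂ) (z : ℂ) : ℂ :=
  -dz (dzbar f) z + ν * conj z * dzbar f z

/-- The first order operator `∇_{ν,a} = -∂_z + ν z̄ - 2 a z`. -/
def nabla (ν a : ℝ) (f : ℂ → ℂ) (z : ℂ) : ℂ :=
  -dz f z + ν * conj z * f z - 2 * a * z * f z

/-- The multiplication operator `M_a : f ↦ exp (a z²) f`. -/
def mulExp (a : ℝ) : (ℂ → ℂ) →ₗ[ℂ] (ℂ → ℂ) where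
  toFun f z := Complex.exp (a * z ^ 2) * f z
  map_add' f g := by
    funext z
    simp [mul_add]
  map_smul' c f := by
    funext z
    simp [mul_left_comm]

/-- The holomorphic Hermite polynomial
`H_m(z) = m! ∑_{k ≤ m/2} (-1)^k / k! * (2z)^(m-2k) / (m-2k)!`. -/
def hermiteH (m : ℕ) (z : ℂ) : ℂ :=
  (m.factorial : ℂ) * ∑ k ∈ Finset.range (m / 2 + 1),
    (-1) ^ k / (k.factorial : ℂ) * ((2 * z) ^ (m - 2 * k) / ((m - 2 * k).factorial : ℂ))

theorem dzbar_add {f g : ℂ → ℂ} (hf : Differentiable ℝ f) (hg : Differentiable ℝ g) :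
    dzbar (f + g) = dzbar f + dzbar g := by
  funext z
  simp only [dzbar, Pi.add_apply, fderiv_add (hf z) (hg z), ContinuousLinearMap.add_apply]
  ring

theorem dz_add {f g : ℂ → ℂ} (hf : Differentiable ℝ f) (hg : Differentiable ℝ g) :
    dz (f + g) = dz f + dz g := by
  funext z
  simp only [dz, Pi.add_apply, fderiv_add (hf z) (hg z), ContinuousLinearMap.add_apply]
  ring

theorem dzbar_smul (c : ℂ) {f : ℂ → ℂ} (hf : Differentiable ℝ f) :
    dzbar (c • f) = c • dzbar f := by
  funext z
  simp only [dzbar, Pi.smul_apply, fderiv_const_smul (hf z) c, ContinuousLinearMap.smul_apply,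
    smul_eq_mul]
  ring

theorem dz_smul (c : ℂ) {f : ℂ → ℂ} (hf : Differentiable ℝ f) :
    dz (c • f) = c • dz f := by
  funext z
  simp only [dz, Pi.smul_apply, fderiv_const_smul (hf z) c, ContinuousLinearMap.smul_apply,
    smul_eq_mul]
  ring

theorem differentiable_dzbar {f : ℂ → ℂ} (hf : ContDiff ℝ 2 f) :
    Differentiable ℝ (dzbar f) := by
  have h : Differentiable ℝ (fderiv ℝ f) :=
    (hf.fderiv_right (m := 1) (by norm_num)).differentiable (by norm_num)
  unfold dzbar
  fun_prop

/-- The space `𝒳_s(ℂ) = ℋol(ℂ) ∩ ℋ^{2,s}(ℂ)`, as a space of functions. -/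
def holSpace (s : ℝ) : Submodule ℂ (ℂ → ℂ) where
  carrier := {f | Differentiable ℂ f ∧ MemLp f 2 (muS s)}
  add_mem' hf hg := ⟨hf.1.add hg.1, hf.2.add hg.2⟩
  zero_mem' := ⟨differentiable_const (0 : ℂ), MemLp.zero⟩
  smul_mem' c _ hf := ⟨hf.1.const_smul c, hf.2.const_smul c⟩

/-- The polyanalytic Hilbert space `ℱ_n^{2,ν}(ℂ) = Ker (Δ_ν - n ν)` in `L²(ℂ, exp (-ν |z|²) dλ)`,
as a space of functions. -/
def polyFock (ν : ℝ) (n : ℕ) : Submodule ℂ (ℂ → ℂ) where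
  carrier := {g | ContDiff ℝ 2 g ∧ MemLp g 2 (fockMeasure ν) ∧
    ∀ z, magLaplacian ν g z = n * ν * g z}
  add_mem' := by
    rintro f g ⟨hf, hf', hf''⟩ ⟨hg, hg', hg''⟩
    refine ⟨hf.add hg, hf'.add hg', fun z => ?_⟩
    have h1 := hf'' z
    have h2 := hg'' z
    simp only [magLaplacian] at h1 h2 ⊢
    rw [dzbar_add (hf.differentiable (by norm_num)) (hg.differentiable (by norm_num)),
      dz_add (differentiable_dzbar hf) (differentiable_dzbar hg)]
    simp only [Pi.add_apply]
    linear_combination h1 + h2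
  zero_mem' := by
    refine ⟨contDiff_const (c := (0 : ℂ)), MemLp.zero, fun z => ?_⟩
    have h : dzbar (0 : ℂ → ℂ) = 0 := by
      funext w
      simp [dzbar]
    simp [magLaplacian, h, dz]
  smul_mem' := by
    rintro c f ⟨hf, hf', hf''⟩
    refine ⟨hf.const_smul c, hf'.const_smul c, fun z => ?_⟩
    have h1 := hf'' z
    simp only [magLaplacian] at h1 ⊢
    rw [dzbar_smul c (hf.differentiable (by norm_num)), dz_smul c (differentiable_dzbar hf)]
    simp only [Pi.smul_apply, smul_eq_mul]
    linear_combination c * h1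

/-- The space `𝒳_{n,s}(ℂ) = M_{-α} ℱ_n^{2,ν}(ℂ)`, as a space of functions. -/
def polySpace (s : ℝ) (n : ℕ) : Submodule ℂ (ℂ → ℂ) :=
  (polyFock (nu s) n).map (mulExp (-alpha s))

/-- The subspace of `L²(ℂ, μ)` formed by the classes of the members of a space of functions. -/
def toL2 (μ : Measure ℂ) (X : Submodule ℂ (ℂ → ℂ)) : Submodule ℂ (Lp ℂ 2 μ) where
  carrier := {F | ∃ f ∈ X, F =ᵐ[μ] f}
  add_mem' := by
    rintro F G ⟨f, hf, hF⟩ ⟨g, hg, hG⟩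
    exact ⟨f + g, X.add_mem hf hg, (Lp.coeFn_add F G).trans (hF.add hG)⟩
  zero_mem' := ⟨0, X.zero_mem, Lp.coeFn_zero ℂ 2 μ⟩
  smul_mem' := by
    rintro c F ⟨f, hf, hF⟩
    exact ⟨c • f, X.smul_mem c hf, (Lp.coeFn_smul c F).trans (hF.const_smul c)⟩

/-- The Hilbert space `𝒳_s(ℂ)` inside `ℋ^{2,s}(ℂ)`. -/
abbrev XHol (s : ℝ) : Submodule ℂ (Lp ℂ 2 (muS s)) := toL2 (muS s) (holSpace s)

/-- The space `𝒳_{n,s}(ℂ)` inside `ℋ^{2,s}(ℂ)`. -/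
abbrev XPoly (s : ℝ) (n : ℕ) : Submodule ℂ (Lp ℂ 2 (muS s)) := toL2 (muS s) (polySpace s n)

/-- The integrand of the transform `𝒲_n^s` at the point `z`. -/
def transformIntegrand (s : ℝ) (n : ℕ) (f : ℂ → ℂ) (z ξ : ℂ) : ℂ :=
  Complex.exp (-nu s * (‖ξ‖ ^ 2 : ℝ) + alpha s * ξ ^ 2 + nu s * conj ξ * z) *
    (conj z - conj ξ) ^ n * f ξ

/-- The integral transform `𝒲_n^s`. -/
def transformW (s : ℝ) (n : ℕ) (f : ℂ → ℂ) (z : ℂ) : ℂ :=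
  ((nu s / Real.pi * Real.sqrt (nu s ^ n / n.factorial) : ℝ) : ℂ) *
    Complex.exp (-alpha s * z ^ 2) * ∫ ξ, transformIntegrand s n f z ξ

/-- The functions `ψ_{m,n}^s`. -/
def psi (s : ℝ) (m n : ℕ) (z : ℂ) : ℂ :=
  ((Real.sqrt ((1 - s) / (Real.pi * nu s ^ n * n.factorial * Real.sqrt s)) *
      ((1 - s) / (1 + s)) ^ ((m : ℝ) / 2) / Real.sqrt (2 ^ m * m.factorial) : ℝ) : ℂ) *
    Complex.exp (-z ^ 2 / 2) * (nabla (nu s) (alpha s - 1 / 2))^[n] (hermiteH m) z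

end HolHermite

end

/-!
Multiplication by `e^{α z²}` maps `ℋ^{2,s}(ℂ)` isometrically onto `L²(ℂ, e^{-ν|z|²} dλ)`
(`inner_toLp_mulExp_neg`) and `𝒳_{n,s}` onto the `n`-th eigenspace of the magnetic Laplacian
`Δ_ν = ∇ ∂_{z̄}`, where `∇ = -∂_z + ν z̄`. With `a = α - 1/2` it sends `ψ_{m,n}^s` to a multiple of
`∇^n u_m`, where `u_m = e^{a z²} H_m` (`psi_eq`).

Orthonormality is algebraic. For the Gaussian weight `∇` is adjoint to `∂_{z̄}` (`gaussPair_nabla`),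
and `[∂_{z̄}, ∇] = ν`, so the pairings of the `∇^n u_m` reduce to those of the holomorphic functions
`u_m` (`gaussPair_creation`). On the latter, `(2 + 2a) z - ∂_z` raises the index `m`, `∂_z - 2 a z`
lowers it, and the two are adjoint up to a constant precisely because `2a(2 + 2a) = ν²`
(`gaussPair_gaussHermite_succ`). What remains is a Gaussian integral.

Completeness in the whole space follows from a moment argument. The `∇^n u_m` span all products of
`e^{a z²}` with a polynomial in `z` and `z̄` (`gaussPoly_le_span_creation`); as `2a < ν`, a function
orthogonal to these has, after multiplication by Gaussian factors, finite exponential moments and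
vanishing polynomial moments, hence zero Fourier transform (`ae_eq_zero_of_moments_eq_zero`).

It remains to identify `𝒳_{n,s}` with the closed span of the `ψ_{m,n}`, `m ≥ 0`. On the one hand,
a square integrable `C²` eigenfunction is orthogonal to the `∇^k u_m` with `k ≠ n`, since `Δ_ν` is
symmetric against rapidly decreasing functions; as the derivatives of the eigenfunction are not
controlled, the integration by parts uses cutoff functions (`gaussPair_eq_zero_of_magLaplacian`). On
the other hand, the integrals `∫ e^{ν z ξ̄} (z̄ - ξ̄)^n f(ξ) e^{-ν|ξ|²} dλ(ξ)` are smooth solutions of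
`Δ_ν g = n ν g` for every square integrable `f` (`magLaplacian_bargmann`), and the mean value property
shows that `𝒲_n^s ψ_{m,0} = ψ_{m,n}` (`transformW_psi`). Since point evaluations of `𝒲_n^s f` are
continuous in `f`, the transform sends `∑ c_m ψ_{m,0}` to `∑ c_m ψ_{m,n}`
(`transformW_ae_eq_of_hasSum`), which yields the regular representatives. The case `n = 0` gives
`𝒳_s = 𝒳_{0,s}`, and so the `𝒲_n^s` are unitary.
-/

open scoped ContDiff

noncomputable section

namespace HolHermite

/-! ### Wirtinger calculus -/

/-- `f` is real differentiable at `z` with Wirtinger derivatives `∂_z f = p` and `∂_{z̄} f = q`,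
that is, with derivative `v ↦ p v + q v̄`. -/
def HasWirtinger (f : ℂ → ℂ) (p q z : ℂ) : Prop :=
  HasFDerivAt f (p • (1 : ℂ →L[ℝ] ℂ) + q • (conjCLE : ℂ →L[ℝ] ℂ)) z

namespace HasWirtinger

variable {f g : ℂ → ℂ} {p q p' q' z : ℂ}

theorem dz (h : HasWirtinger f p q z) : dz f z = p := by
  unfold HasWirtinger at h
  simp only [HolHermite.dz, h.fderiv]
  simp
  linear_combination (q / 2 - p / 2) * I_mul_I

theorem dzbar (h : HasWirtinger f p q z) : dzbar f z = q := by
  unfold HasWirtinger at h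
  simp only [HolHermite.dzbar, h.fderiv]
  simp
  linear_combination (p / 2 - q / 2) * I_mul_I

theorem congr_deriv (h : HasWirtinger f p q z) (hp : p = p') (hq : q = q') :
    HasWirtinger f p' q' z := hp ▸ hq ▸ h

theorem add (hf : HasWirtinger f p q z) (hg : HasWirtinger g p' q' z) :
    HasWirtinger (fun w => f w + g w) (p + p') (q + q') z :=
  (HasFDerivAt.add hf hg).congr_fderiv (by ext; simp; ring)

theorem neg (hf : HasWirtinger f p q z) : HasWirtinger (fun w => -f w) (-p) (-q) z :=
  (HasFDerivAt.neg hf).congr_fderiv (by ext; simp; ring)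

theorem mul (hf : HasWirtinger f p q z) (hg : HasWirtinger g p' q' z) :
    HasWirtinger (fun w => f w * g w) (p * g z + f z * p') (q * g z + f z * q') z :=
  (HasFDerivAt.mul hf hg).congr_fderiv (by ext; simp; ring)

theorem const_mul (c : ℂ) (hf : HasWirtinger f p q z) :
    HasWirtinger (fun w => c * f w) (c * p) (c * q) z :=
  (HasFDerivAt.const_mul hf c).congr_fderiv (by ext; simp; ring)

theorem star (hf : HasWirtinger f p q z) :
    HasWirtinger (fun w => conj (f w)) (conj q) (conj p) z :=
  ((conjCLE : ℂ →L[ℝ] ℂ).hasFDerivAt.comp z hf).congr_fderiv (by ext; simp; ring)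

/-- Chain rule for the composition with a holomorphic function. -/
theorem comp {φ : ℂ → ℂ} {φ' : ℂ} (hφ : HasDerivAt φ φ' (f z)) (hf : HasWirtinger f p q z) :
    HasWirtinger (fun w => φ (f w)) (φ' * p) (φ' * q) z :=
  ((hφ.hasFDerivAt.restrictScalars ℝ).comp z hf).congr_fderiv (by ext; simp; ring)

end HasWirtinger

theorem HasDerivAt.hasWirtinger {f : ℂ → ℂ} {p z : ℂ} (h : HasDerivAt f p z) :
    HasWirtinger f p 0 z :=
  (h.hasFDerivAt.restrictScalars ℝ).congr_fderiv (by ext; simp [mul_comm])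

theorem hasWirtinger_id (z : ℂ) : HasWirtinger (fun w => w) 1 0 z :=
  HasDerivAt.hasWirtinger (hasDerivAt_id z)

theorem hasWirtinger_conj (z : ℂ) : HasWirtinger (fun w => conj w) 0 1 z :=
  (hasWirtinger_id z).star.congr_deriv (by simp) (by simp)

theorem DifferentiableAt.hasWirtinger {f : ℂ → ℂ} {z : ℂ} (h : DifferentiableAt ℝ f z) :
    HasWirtinger f (dz f z) (dzbar f z) z := by
  refine h.hasFDerivAt.congr_fderiv ?_
  ext v
  have hv : v = (v.re : ℝ) • (1 : ℂ) + (v.im : ℝ) • I := by simp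
  have h1 : fderiv ℝ f z v = v.re * fderiv ℝ f z 1 + v.im * fderiv ℝ f z I := by
    conv_lhs => rw [hv, map_add, map_smul, map_smul, real_smul, real_smul]
  rw [h1]
  have hre : (v.re : ℂ) = (v + conj v) / 2 := re_eq_add_conj v
  have him : I * (v.im : ℂ) = (v - conj v) / 2 := by
    rw [im_eq_sub_conj]
    field_simp
  simp only [dz, dzbar]
  simp
  linear_combination fderiv ℝ f z 1 * hre - I * fderiv ℝ f z I * him +
    (v.im * fderiv ℝ f z I) * I_mul_I

theorem ContDiff.hasWirtinger {f : ℂ → ℂ} {n : WithTop ℕ∞} (h : ContDiff ℝ n f) (hn : n ≠ 0)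
    (z : ℂ) : HasWirtinger f (dz f z) (dzbar f z) z :=
  DifferentiableAt.hasWirtinger (h.differentiable hn z)

theorem HasWirtinger.fderiv_one {f : ℂ → ℂ} {p q z : ℂ} (h : HasWirtinger f p q z) :
    fderiv ℝ f z 1 = p + q := by
  unfold HasWirtinger at h
  simp [h.fderiv]

theorem HasWirtinger.fderiv_I {f : ℂ → ℂ} {p q z : ℂ} (h : HasWirtinger f p q z) :
    fderiv ℝ f z I = I * (p - q) := by
  unfold HasWirtinger at h
  simp [h.fderiv]
  ring

theorem contDiff_dz {f : ℂ → ℂ} {m n : WithTop ℕ∞} (h : ContDiff ℝ n f) (hmn : m + 1 ≤ n) :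
    ContDiff ℝ m (dz f) := by
  have h' : ContDiff ℝ m (fderiv ℝ f) := h.fderiv_right hmn
  unfold dz
  fun_prop

theorem contDiff_dzbar {f : ℂ → ℂ} {m n : WithTop ℕ∞} (h : ContDiff ℝ n f) (hmn : m + 1 ≤ n) :
    ContDiff ℝ m (dzbar f) := by
  have h' : ContDiff ℝ m (fderiv ℝ f) := h.fderiv_right hmn
  unfold dzbar
  fun_prop

theorem dz_dzbar_comm {f : ℂ → ℂ} (h : ContDiff ℝ 2 f) (z : ℂ) :
    dz (dzbar f) z = dzbar (dz f) z := by
  have h1 : Differentiable ℝ (fderiv ℝ f) :=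
    (h.fderiv_right (m := 1) (by norm_num)).differentiable (by norm_num)
  have hsymm : fderiv ℝ (fderiv ℝ f) z 1 I = fderiv ℝ (fderiv ℝ f) z I 1 :=
    (h.contDiffAt.isSymmSndFDerivAt (by simp)).eq 1 I
  have e1 (v : ℂ) : HasFDerivAt (fun y => fderiv ℝ f y v)
      ((ContinuousLinearMap.apply ℝ ℂ v).comp (fderiv ℝ (fderiv ℝ f) z)) z :=
    (ContinuousLinearMap.apply ℝ ℂ v).hasFDerivAt.comp z (h1 z).hasFDerivAt
  have h2 : fderiv ℝ (dz f) z = (1 / 2 : ℂ) •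
      ((ContinuousLinearMap.apply ℝ ℂ 1).comp (fderiv ℝ (fderiv ℝ f) z) -
        I • (ContinuousLinearMap.apply ℝ ℂ I).comp (fderiv ℝ (fderiv ℝ f) z)) := by
    refine HasFDerivAt.fderiv ?_
    convert! (((e1 1).sub ((e1 I).const_smul I)).const_smul (1 / 2 : ℂ)) using 1
    funext y
    simp [dz]
    ring
  have h3 : fderiv ℝ (dzbar f) z = (1 / 2 : ℂ) •
      ((ContinuousLinearMap.apply ℝ ℂ 1).comp (fderiv ℝ (fderiv ℝ f) z) +
        I • (ContinuousLinearMap.apply ℝ ℂ I).comp (fderiv ℝ (fderiv ℝ f) z)) := by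
    refine HasFDerivAt.fderiv ?_
    convert! (((e1 1).add ((e1 I).const_smul I)).const_smul (1 / 2 : ℂ)) using 1
    funext y
    simp [dzbar]
    ring
  rw [dz, dzbar, h2, h3]
  simp [hsymm]
  ring

/-- Integration by parts for `∂_z`. -/
theorem integral_mul_dz {u v : ℂ → ℂ} (hu : Differentiable ℝ u) (hv : Differentiable ℝ v)
    (h0 : Integrable fun z => u z * v z)
    (h1 : Integrable fun z => fderiv ℝ u z 1 * v z) (h2 : Integrable fun z => fderiv ℝ u z I * v z)
    (h3 : Integrable fun z => u z * fderiv ℝ v z 1)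
    (h4 : Integrable fun z => u z * fderiv ℝ v z I) :
    ∫ z, u z * dz v z = -∫ z, dz u z * v z := by
  have e1 := integral_mul_fderiv_eq_neg_fderiv_mul_of_integrable h1 h3 h0
    (fun x _ => hu x) (fun x _ => hv x)
  have e2 := integral_mul_fderiv_eq_neg_fderiv_mul_of_integrable h2 h4 h0
    (fun x _ => hu x) (fun x _ => hv x)
  have l : ∫ z, u z * dz v z =
      (1 / 2 : ℂ) * (∫ z, u z * fderiv ℝ v z 1) - I / 2 * ∫ z, u z * fderiv ℝ v z I := by
    rw [← integral_const_mul, ← integral_const_mul, ← integral_sub (h3.const_mul _)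
      (h4.const_mul _)]
    refine integral_congr_ae (.of_forall fun z => ?_)
    simp only [dz]
    ring
  have r : ∫ z, dz u z * v z =
      (1 / 2 : ℂ) * (∫ z, fderiv ℝ u z 1 * v z) - I / 2 * ∫ z, fderiv ℝ u z I * v z := by
    rw [← integral_const_mul, ← integral_const_mul, ← integral_sub (h1.const_mul _)
      (h2.const_mul _)]
    refine integral_congr_ae (.of_forall fun z => ?_)
    simp only [dz]
    ring
  rw [l, r, e1, e2]
  ring

/-- Integration by parts for `∂_{z̄}`. -/
theorem integral_mul_dzbar {u v : ℂ → ℂ} (hu : Differentiable ℝ u) (hv : Differentiable ℝ v)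
    (h0 : Integrable fun z => u z * v z)
    (h1 : Integrable fun z => fderiv ℝ u z 1 * v z) (h2 : Integrable fun z => fderiv ℝ u z I * v z)
    (h3 : Integrable fun z => u z * fderiv ℝ v z 1)
    (h4 : Integrable fun z => u z * fderiv ℝ v z I) :
    ∫ z, u z * dzbar v z = -∫ z, dzbar u z * v z := by
  have e1 := integral_mul_fderiv_eq_neg_fderiv_mul_of_integrable h1 h3 h0
    (fun x _ => hu x) (fun x _ => hv x)
  have e2 := integral_mul_fderiv_eq_neg_fderiv_mul_of_integrable h2 h4 h0
    (fun x _ => hu x) (fun x _ => hv x)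
  have l : ∫ z, u z * dzbar v z =
      (1 / 2 : ℂ) * (∫ z, u z * fderiv ℝ v z 1) + I / 2 * ∫ z, u z * fderiv ℝ v z I := by
    rw [← integral_const_mul, ← integral_const_mul, ← integral_add (h3.const_mul _)
      (h4.const_mul _)]
    refine integral_congr_ae (.of_forall fun z => ?_)
    simp only [dzbar]
    ring
  have r : ∫ z, dzbar u z * v z =
      (1 / 2 : ℂ) * (∫ z, fderiv ℝ u z 1 * v z) + I / 2 * ∫ z, fderiv ℝ u z I * v z := by
    rw [← integral_const_mul, ← integral_const_mul, ← integral_add (h1.const_mul _)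
      (h2.const_mul _)]
    refine integral_congr_ae (.of_forall fun z => ?_)
    simp only [dzbar]
    ring
  rw [l, r, e1, e2]
  ring

/-- The Gaussian weight `e^{-ν |z|²}`, as a complex valued function. -/
def gaussW (ν : ℝ) (z : ℂ) : ℂ := Complex.exp (-ν * (z * conj z))

theorem gaussW_eq (ν : ℝ) (z : ℂ) : gaussW ν z = (Real.exp (-ν * ‖z‖ ^ 2) : ℝ) := by
  rw [gaussW, mul_conj, normSq_eq_norm_sq]
  push_cast
  rfl

theorem norm_gaussW (ν : ℝ) (z : ℂ) : ‖gaussW ν z‖ = Real.exp (-ν * ‖z‖ ^ 2) := by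
  rw [gaussW_eq, norm_real, Real.norm_of_nonneg (Real.exp_pos _).le]

theorem contDiff_gaussW (ν : ℝ) {n : WithTop ℕ∞} : ContDiff ℝ n (gaussW ν) := by
  have h : ContDiff ℝ n (fun z : ℂ => conj z) := conjCLE.contDiff
  unfold gaussW
  fun_prop

theorem hasWirtinger_gaussW (ν : ℝ) (z : ℂ) :
    HasWirtinger (gaussW ν) (-ν * conj z * gaussW ν z) (-ν * z * gaussW ν z) z := by
  refine (HasWirtinger.comp (f := fun z => -ν * (z * conj z)) (Complex.hasDerivAt_exp _)
    (((hasWirtinger_id z).mul (hasWirtinger_conj z)).const_mul (-ν : ℂ))).congr_deriv ?_ ?_ <;>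
  · simp only [gaussW]
    ring

/-! ### Functions of Gaussian growth -/

/-- `f` is bounded by a multiple of `e^{b |z|²}`. -/
def GaussBound (b : ℝ) (f : ℂ → ℂ) : Prop :=
  ∃ C : ℝ, ∀ z, ‖f z‖ ≤ C * Real.exp (b * ‖z‖ ^ 2)

namespace GaussBound

variable {b c : ℝ} {f g : ℂ → ℂ}

theorem add (hf : GaussBound b f) (hg : GaussBound b g) : GaussBound b (fun z => f z + g z) := by
  obtain ⟨C, hC⟩ := hf
  obtain ⟨D, hD⟩ := hg
  refine ⟨C + D, fun z => (norm_add_le _ _).trans ?_⟩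
  linarith [hC z, hD z]

theorem mul (hf : GaussBound b f) (hg : GaussBound c g) :
    GaussBound (b + c) (fun z => f z * g z) := by
  obtain ⟨C, hC⟩ := hf
  obtain ⟨D, hD⟩ := hg
  refine ⟨C * D, fun z => ?_⟩
  rw [norm_mul, add_mul, Real.exp_add]
  calc ‖f z‖ * ‖g z‖ ≤ (C * Real.exp (b * ‖z‖ ^ 2)) * (D * Real.exp (c * ‖z‖ ^ 2)) :=
        mul_le_mul (hC z) (hD z) (norm_nonneg _) ((norm_nonneg _).trans (hC z))
    _ = _ := by ring

theorem const_mul (k : ℂ) (hf : GaussBound b f) : GaussBound b (fun z => k * f z) := by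
  obtain ⟨C, hC⟩ := hf
  refine ⟨‖k‖ * C, fun z => ?_⟩
  rw [norm_mul, mul_assoc]
  exact mul_le_mul_of_nonneg_left (hC z) (norm_nonneg _)

theorem of_norm_le (hg : GaussBound b g) (h : ∀ z, ‖f z‖ ≤ ‖g z‖) : GaussBound b f := by
  obtain ⟨C, hC⟩ := hg
  exact ⟨C, fun z => (h z).trans (hC z)⟩

theorem star (hf : GaussBound b f) : GaussBound b (fun z => conj (f z)) :=
  hf.of_norm_le fun z => by simp

theorem mono (hf : GaussBound b f) (hbc : b ≤ c) : GaussBound c f := by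
  obtain ⟨C, hC⟩ := hf
  have hC0 : 0 ≤ C := by
    have := (norm_nonneg _).trans (hC 0)
    simpa using this
  refine ⟨C, fun z => (hC z).trans ?_⟩
  gcongr

end GaussBound

theorem gaussBound_gaussW (ν : ℝ) : GaussBound (-ν) (gaussW ν) :=
  ⟨1, fun z => by rw [norm_gaussW, one_mul]⟩

theorem integrable_exp_neg_mul_norm_sq {c : ℝ} (hc : 0 < c) :
    Integrable fun z : ℂ => Real.exp (-c * ‖z‖ ^ 2) := by
  have h := (GaussianFourier.integrable_cexp_neg_mul_sq_norm_add (V := ℂ) (b := (c : ℂ))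
    (by simpa using hc) 0 0).norm
  refine h.congr (.of_forall fun z => ?_)
  simp [Complex.norm_exp, ← ofReal_pow, ← ofReal_neg, ← ofReal_mul]

theorem GaussBound.integrable {b : ℝ} {f : ℂ → ℂ} (hf : GaussBound b f) (hb : b < 0)
    (hc : Continuous f) : Integrable f := by
  obtain ⟨C, hC⟩ := hf
  have h := (integrable_exp_neg_mul_norm_sq (c := -b) (by linarith)).const_mul C
  refine h.mono' hc.aestronglyMeasurable (.of_forall fun z => ?_)
  simpa using hC z

theorem pow_le_mul_exp_sq (n : ℕ) {δ : ℝ} (hδ : 0 < δ) :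
    ∃ C : ℝ, ∀ x : ℝ, 0 ≤ x → x ^ n ≤ C * Real.exp (δ * x ^ 2) := by
  refine ⟨1 + n.factorial / δ ^ n, fun x hx => ?_⟩
  have h1 : x ^ n ≤ 1 + x ^ (2 * n) := by
    have e : x ^ (2 * n) = (x ^ n) ^ 2 := by ring
    rw [e]
    nlinarith [sq_nonneg (x ^ n - 1)]
  have h2 := Real.pow_div_factorial_le_exp (δ * x ^ 2) (by positivity) n
  have h3 : x ^ (2 * n) ≤ n.factorial / δ ^ n * Real.exp (δ * x ^ 2) := by
    rw [div_le_iff₀ (by positivity)] at h2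
    rw [div_mul_eq_mul_div, le_div_iff₀ (by positivity)]
    calc x ^ (2 * n) * δ ^ n = (δ * x ^ 2) ^ n := by ring
      _ ≤ _ := by linarith
  have h4 : 1 ≤ Real.exp (δ * x ^ 2) := Real.one_le_exp (by positivity)
  linarith

theorem gaussBound_pow (n : ℕ) {δ : ℝ} (hδ : 0 < δ) : GaussBound δ (fun z => z ^ n) := by
  obtain ⟨C, hC⟩ := pow_le_mul_exp_sq n hδ
  exact ⟨C, fun z => by simpa using hC ‖z‖ (norm_nonneg z)⟩

/-! ### Polynomials in `z` and `z̄` times `e^{a z²}` -/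

/-- The function `e^{a z²} z^j z̄^k`. -/
def gaussMonomial (a : ℝ) (j k : ℕ) (z : ℂ) : ℂ := Complex.exp (a * z ^ 2) * z ^ j * conj z ^ k

/-- The space of the functions `e^{a z²} p(z, z̄)` with `p` a polynomial. -/
def gaussPoly (a : ℝ) : Submodule ℂ (ℂ → ℂ) :=
  Submodule.span ℂ (Set.range fun p : ℕ × ℕ => gaussMonomial a p.1 p.2)

theorem gaussMonomial_mem (a : ℝ) (j k : ℕ) : gaussMonomial a j k ∈ gaussPoly a :=
  Submodule.subset_span ⟨(j, k), rfl⟩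

theorem contDiff_gaussMonomial (a : ℝ) (j k : ℕ) {n : WithTop ℕ∞} :
    ContDiff ℝ n (gaussMonomial a j k) := by
  have h : ContDiff ℝ n (fun z : ℂ => conj z) := conjCLE.contDiff
  unfold gaussMonomial
  fun_prop

theorem hasDerivAt_cexp_mul_sq (a z : ℂ) :
    HasDerivAt (fun z : ℂ => Complex.exp (a * z ^ 2)) (2 * a * z * Complex.exp (a * z ^ 2)) z := by
  refine ((hasDerivAt_pow 2 z).const_mul a).cexp.congr_deriv ?_
  simp
  ring

theorem hasWirtinger_gaussMonomial (a : ℝ) (j k : ℕ) (z : ℂ) :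
    HasWirtinger (gaussMonomial a j k)
      (2 * a * gaussMonomial a (j + 1) k z + j * gaussMonomial a (j - 1) k z)
      (k * gaussMonomial a j (k - 1) z) z := by
  have h1 := HasDerivAt.hasWirtinger ((hasDerivAt_cexp_mul_sq a z).mul (hasDerivAt_pow j z))
  have h3 := HasWirtinger.comp (f := fun w => conj w) (hasDerivAt_pow k (conj z))
    (hasWirtinger_conj z)
  refine (h1.mul h3).congr_deriv ?_ ?_ <;>
  · simp only [gaussMonomial, Pi.mul_apply]
    ring

section

variable {a : ℝ} {f : ℂ → ℂ}

theorem gaussPoly_induction {P : (ℂ → ℂ) → Prop} (hm : ∀ j k, P (gaussMonomial a j k))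
    (h0 : P 0) (hadd : ∀ f g, f ∈ gaussPoly a → g ∈ gaussPoly a → P f → P g → P (f + g))
    (hsmul : ∀ (c : ℂ) f, f ∈ gaussPoly a → P f → P (c • f)) (hf : f ∈ gaussPoly a) : P f := by
  induction hf using Submodule.span_induction with
  | mem x hx => obtain ⟨p, rfl⟩ := hx; exact hm p.1 p.2
  | zero => exact h0
  | add x y hx hy h1 h2 => exact hadd x y hx hy h1 h2
  | smul c x hx h => exact hsmul c x hx h

theorem contDiff_of_mem_gaussPoly (hf : f ∈ gaussPoly a) {n : WithTop ℕ∞} : ContDiff ℝ n f :=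
  gaussPoly_induction (fun j k => contDiff_gaussMonomial a j k) contDiff_const
    (fun _ _ _ _ h1 h2 => h1.add h2) (fun c _ _ h => h.const_smul c) hf

theorem differentiable_of_mem_gaussPoly (hf : f ∈ gaussPoly a) : Differentiable ℝ f :=
  (contDiff_of_mem_gaussPoly (n := 1) hf).differentiable (by norm_num)

theorem mul_id_mem_gaussPoly (hf : f ∈ gaussPoly a) : (fun z => z * f z) ∈ gaussPoly a := by
  refine gaussPoly_induction (P := fun f => (fun z => z * f z) ∈ gaussPoly a) ?_ ?_ ?_ ?_ hf
  · intro j k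
    convert gaussMonomial_mem a (j + 1) k using 1
    funext z
    simp only [gaussMonomial]
    ring
  · simp only [Pi.zero_apply, mul_zero]
    exact zero_mem _
  · intro f g _ _ h1 h2
    convert add_mem h1 h2 using 1
    funext z
    simp only [Pi.add_apply, mul_add]
  · intro c f _ h
    convert Submodule.smul_mem _ c h using 1
    funext z
    simp only [Pi.smul_apply, smul_eq_mul]
    ring

theorem mul_conj_mem_gaussPoly (hf : f ∈ gaussPoly a) :
    (fun z => conj z * f z) ∈ gaussPoly a := by
  refine gaussPoly_induction (P := fun f => (fun z => conj z * f z) ∈ gaussPoly a) ?_ ?_ ?_ ?_ hf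
  · intro j k
    convert gaussMonomial_mem a j (k + 1) using 1
    funext z
    simp only [gaussMonomial]
    ring
  · simp only [Pi.zero_apply, mul_zero]
    exact zero_mem _
  · intro f g _ _ h1 h2
    convert add_mem h1 h2 using 1
    funext z
    simp only [Pi.add_apply, mul_add]
  · intro c f _ h
    convert Submodule.smul_mem _ c h using 1
    funext z
    simp only [Pi.smul_apply, smul_eq_mul]
    ring

theorem dz_mem_gaussPoly (hf : f ∈ gaussPoly a) : dz f ∈ gaussPoly a := by
  refine gaussPoly_induction (P := fun f => dz f ∈ gaussPoly a) ?_ ?_ ?_ ?_ hf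
  · intro j k
    have h := add_mem (Submodule.smul_mem _ (2 * a : ℂ) (gaussMonomial_mem a (j + 1) k))
      (Submodule.smul_mem _ (j : ℂ) (gaussMonomial_mem a (j - 1) k))
    convert h using 1
    funext z
    exact (hasWirtinger_gaussMonomial a j k z).dz
  · convert zero_mem (gaussPoly a) using 1
    funext z
    simp [dz]
  · intro f g hf hg h1 h2
    rw [dz_add (differentiable_of_mem_gaussPoly hf) (differentiable_of_mem_gaussPoly hg)]
    exact add_mem h1 h2
  · intro c f hf h
    rw [dz_smul c (differentiable_of_mem_gaussPoly hf)]
    exact Submodule.smul_mem _ c h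

theorem dzbar_mem_gaussPoly (hf : f ∈ gaussPoly a) : dzbar f ∈ gaussPoly a := by
  refine gaussPoly_induction (P := fun f => dzbar f ∈ gaussPoly a) ?_ ?_ ?_ ?_ hf
  · intro j k
    have h := Submodule.smul_mem _ (k : ℂ) (gaussMonomial_mem a j (k - 1))
    convert h using 1
    funext z
    exact (hasWirtinger_gaussMonomial a j k z).dzbar
  · convert zero_mem (gaussPoly a) using 1
    funext z
    simp [dzbar]
  · intro f g hf hg h1 h2
    rw [dzbar_add (differentiable_of_mem_gaussPoly hf) (differentiable_of_mem_gaussPoly hg)]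
    exact add_mem h1 h2
  · intro c f hf h
    rw [dzbar_smul c (differentiable_of_mem_gaussPoly hf)]
    exact Submodule.smul_mem _ c h

theorem nabla_eq (ν : ℝ) (f : ℂ → ℂ) :
    nabla ν 0 f = -dz f + (ν : ℂ) • fun z => conj z * f z := by
  funext z
  simp [nabla, mul_assoc]

theorem nabla_mem_gaussPoly (ν : ℝ) (hf : f ∈ gaussPoly a) : nabla ν 0 f ∈ gaussPoly a := by
  rw [nabla_eq]
  exact add_mem (neg_mem (dz_mem_gaussPoly hf)) (Submodule.smul_mem _ _ (mul_conj_mem_gaussPoly hf))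

theorem gaussBound_of_mem_gaussPoly {b : ℝ} (ha : 0 ≤ a) (hab : a < b) (hf : f ∈ gaussPoly a) :
    GaussBound b f := by
  refine gaussPoly_induction (P := fun f => GaussBound b f) ?_ ?_ ?_ ?_ hf
  · intro j k
    have hδ : 0 < b - a := by linarith
    have h1 : GaussBound a (fun z => Complex.exp (a * z ^ 2)) := by
      refine ⟨1, fun z => ?_⟩
      rw [Complex.norm_exp, one_mul, Real.exp_le_exp, ← norm_pow, re_ofReal_mul]
      exact mul_le_mul_of_nonneg_left (re_le_norm _) ha
    have h2 := (h1.mul (gaussBound_pow (j + k) hδ)).mono (show a + (b - a) ≤ b by linarith)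
    refine h2.of_norm_le fun z => le_of_eq ?_
    simp [gaussMonomial, pow_add, mul_assoc]
  · exact ⟨0, fun z => by simp⟩
  · intro f g _ _ h1 h2
    exact h1.add h2
  · intro c f _ h
    exact h.const_mul c

end

/-! ### The weighted pairing -/

/-- The pairing `∫ conj(u) v e^{-ν|z|²} dλ`. -/
def gaussPair (ν : ℝ) (u v : ℂ → ℂ) : ℂ := ∫ z, conj (u z) * v z * gaussW ν z

section

variable {a ν : ℝ} {u v w : ℂ → ℂ}

theorem integrable_gaussPair (ha : 0 ≤ a) (haν : 2 * a < ν) (hu : u ∈ gaussPoly a)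
    (hv : v ∈ gaussPoly a) : Integrable fun z => conj (u z) * v z * gaussW ν z := by
  obtain ⟨b, hab, hbν⟩ := exists_between (show a < ν / 2 by linarith)
  refine (((gaussBound_of_mem_gaussPoly ha hab hu).star.mul
    (gaussBound_of_mem_gaussPoly ha hab hv)).mul (gaussBound_gaussW ν)).integrable (by linarith) ?_
  have h1 := (contDiff_of_mem_gaussPoly (n := 0) hu).continuous
  have h2 := (contDiff_of_mem_gaussPoly (n := 0) hv).continuous
  have h3 := (contDiff_gaussW ν (n := 0)).continuous
  fun_prop

theorem gaussPair_add_right (ha : 0 ≤ a) (haν : 2 * a < ν) (hu : u ∈ gaussPoly a)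
    (hv : v ∈ gaussPoly a) (hw : w ∈ gaussPoly a) :
    gaussPair ν u (v + w) = gaussPair ν u v + gaussPair ν u w := by
  rw [gaussPair, gaussPair, gaussPair, ← integral_add (integrable_gaussPair ha haν hu hv)
    (integrable_gaussPair ha haν hu hw)]
  refine integral_congr_ae (.of_forall fun z => ?_)
  simp only [Pi.add_apply]
  ring

theorem gaussPair_smul_right (c : ℂ) : gaussPair ν u (c • v) = c * gaussPair ν u v := by
  rw [gaussPair, gaussPair, ← integral_const_mul]
  refine integral_congr_ae (.of_forall fun z => ?_)
  simp only [Pi.smul_apply, smul_eq_mul]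
  ring

theorem conj_gaussPair : conj (gaussPair ν u v) = gaussPair ν v u := by
  rw [gaussPair, gaussPair, ← integral_conj]
  refine integral_congr_ae (.of_forall fun z => ?_)
  simp only [gaussW_eq, map_mul, conj_conj, conj_ofReal]
  ring

theorem gaussPair_add_left (ha : 0 ≤ a) (haν : 2 * a < ν) (hu : u ∈ gaussPoly a)
    (hv : v ∈ gaussPoly a) (hw : w ∈ gaussPoly a) :
    gaussPair ν (v + w) u = gaussPair ν v u + gaussPair ν w u := by
  rw [← conj_gaussPair, gaussPair_add_right ha haν hu hv hw, map_add, conj_gaussPair,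
    conj_gaussPair]

theorem gaussPair_smul_left (c : ℂ) : gaussPair ν (c • u) v = conj c * gaussPair ν u v := by
  rw [← conj_gaussPair, gaussPair_smul_right, map_mul, conj_gaussPair]

/-- With respect to the weight `e^{-ν|z|²}`, the creation operator `-∂_z + ν z̄` is adjoint to
`∂_{z̄}`. -/
theorem gaussPair_nabla (ha : 0 ≤ a) (haν : 2 * a < ν) (hu : u ∈ gaussPoly a)
    (hv : v ∈ gaussPoly a) : gaussPair ν u (nabla ν 0 v) = gaussPair ν (dzbar u) v := by
  have hcd {n : WithTop ℕ∞} : ContDiff ℝ n fun z => conj (u z) * gaussW ν z :=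
    (conjCLE.contDiff.comp (contDiff_of_mem_gaussPoly hu)).mul (contDiff_gaussW ν)
  have hW (z : ℂ) : HasWirtinger (fun z => conj (u z) * gaussW ν z)
      (conj (dzbar u z) * gaussW ν z - ν * conj z * (conj (u z) * gaussW ν z))
      (conj (dz u z) * gaussW ν z - ν * z * (conj (u z) * gaussW ν z)) z :=
    ((DifferentiableAt.hasWirtinger (differentiable_of_mem_gaussPoly hu z)).star.mul
      (hasWirtinger_gaussW ν z)).congr_deriv (by ring) (by ring)
  have hV (z : ℂ) := DifferentiableAt.hasWirtinger (differentiable_of_mem_gaussPoly hv z)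
  have i {p q : ℂ → ℂ} (hp : p ∈ gaussPoly a) (hq : q ∈ gaussPoly a) :=
    integrable_gaussPair ha haν hp hq
  have hdu := dz_mem_gaussPoly hu
  have hdu' := dzbar_mem_gaussPoly hu
  have hdv := dz_mem_gaussPoly hv
  have hdv' := dzbar_mem_gaussPoly hv
  have hzv := mul_id_mem_gaussPoly hv
  have hzv' := mul_conj_mem_gaussPoly hv
  have key := integral_mul_dz (u := fun z => conj (u z) * gaussW ν z) (v := v)
    (hcd.differentiable one_ne_zero) (differentiable_of_mem_gaussPoly hv)
    ((i hu hv).congr (.of_forall fun z => by simp only []; ring)) ?_ ?_ ?_ ?_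
  · have e1 : gaussPair ν u (nabla ν 0 v) = -(∫ z, conj (u z) * gaussW ν z * dz v z) +
        ∫ z, ν * (conj (u z) * (conj z * v z) * gaussW ν z) := by
      rw [← integral_neg, ← integral_add, gaussPair]
      · refine integral_congr_ae (.of_forall fun z => ?_)
        simp only [nabla, ofReal_zero]
        ring
      · exact ((i hu hdv).congr (.of_forall fun z => by simp only []; ring)).neg
      · exact (i hu hzv').const_mul _
    rw [e1, key, neg_neg, gaussPair, ← integral_add]
    · refine integral_congr_ae (.of_forall fun z => ?_)
      simp only [(hW z).dz]
      ring
    · refine ((i hdu' hv).sub ((i hu hzv').const_mul ν)).congr (.of_forall fun z => ?_)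
      simp only [Pi.sub_apply, (hW z).dz]
      ring
    · exact (i hu hzv').const_mul _
  · refine (((i hdu' hv).add (i hdu hv)).sub
      (((i hu hzv').const_mul ν).add ((i hu hzv).const_mul ν))).congr (.of_forall fun z => ?_)
    simp only [Pi.sub_apply, Pi.add_apply, (hW z).fderiv_one]
    ring
  · refine ((((i hdu' hv).sub (i hdu hv)).sub
      (((i hu hzv').const_mul ν).sub ((i hu hzv).const_mul ν))).const_mul I).congr
      (.of_forall fun z => ?_)
    simp only [Pi.sub_apply, (hW z).fderiv_I]
    ring
  · refine ((i hu hdv).add (i hu hdv')).congr (.of_forall fun z => ?_)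
    simp only [Pi.add_apply, (hV z).fderiv_one]
    ring
  · refine (((i hu hdv).sub (i hu hdv')).const_mul I).congr (.of_forall fun z => ?_)
    simp only [Pi.sub_apply, (hV z).fderiv_I]
    ring

end

/-! ### Holomorphic Hermite polynomials -/

/-- The `k`-th term of the sum defining `H_m`, extended by zero to all `k`. -/
def hermiteTerm (m k : ℕ) (z : ℂ) : ℂ :=
  if 2 * k ≤ m then
    (m.factorial : ℂ) * ((-1) ^ k / (k.factorial : ℂ) *
      ((2 * z) ^ (m - 2 * k) / ((m - 2 * k).factorial : ℂ)))
  else 0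

theorem hermiteH_eq_sum {m N : ℕ} (h : m < 2 * N) (z : ℂ) :
    hermiteH m z = ∑ k ∈ Finset.range N, hermiteTerm m k z := by
  have h1 : ∑ k ∈ Finset.range N, hermiteTerm m k z =
      ∑ k ∈ Finset.range (m / 2 + 1), hermiteTerm m k z := by
    refine (Finset.sum_subset (fun k hk => ?_) fun k _ hk => ?_).symm
    · rw [Finset.mem_range] at hk ⊢
      omega
    · rw [Finset.mem_range] at hk
      rw [hermiteTerm, if_neg (by omega)]
  rw [h1, hermiteH, Finset.mul_sum]
  refine Finset.sum_congr rfl fun k hk => ?_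
  rw [Finset.mem_range] at hk
  rw [hermiteTerm, if_pos (by omega)]

theorem hermiteTerm_zero_succ (m : ℕ) (z : ℂ) :
    hermiteTerm (m + 1) 0 z = 2 * z * hermiteTerm m 0 z := by
  have h1 : (m.factorial : ℂ) ≠ 0 := by exact_mod_cast m.factorial_ne_zero
  have h2 : ((m + 1).factorial : ℂ) ≠ 0 := by exact_mod_cast (m + 1).factorial_ne_zero
  simp only [hermiteTerm]
  simp
  field_simp
  ring

theorem hermiteTerm_succ (m k : ℕ) (z : ℂ) :
    hermiteTerm (m + 2) (k + 1) z =
      2 * z * hermiteTerm (m + 1) (k + 1) z - 2 * (m + 1) * hermiteTerm m k z := by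
  simp only [hermiteTerm]
  rcases lt_trichotomy m (2 * k) with h | h | h
  · rw [if_neg (by omega), if_neg (by omega), if_neg (by omega)]
    simp
  · subst h
    rw [if_pos (by omega), if_neg (by omega), if_pos (by omega)]
    have e1 : 2 * k + 2 - 2 * (k + 1) = 0 := by omega
    have e2 : 2 * k - 2 * k = 0 := by omega
    rw [e1, e2, Nat.factorial_succ (2 * k + 1), Nat.factorial_succ (2 * k), Nat.factorial_succ k]
    have h1 : (k.factorial : ℂ) ≠ 0 := by exact_mod_cast k.factorial_ne_zero
    have h2 : (k : ℂ) + 1 ≠ 0 := by exact_mod_cast k.succ_ne_zero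
    push_cast
    simp
    field_simp
    ring
  · obtain ⟨d, rfl⟩ := Nat.exists_eq_add_of_lt h
    rw [if_pos (by omega), if_pos (by omega), if_pos (by omega)]
    have e1 : 2 * k + d + 1 + 2 - 2 * (k + 1) = d + 1 := by omega
    have e2 : 2 * k + d + 1 + 1 - 2 * (k + 1) = d := by omega
    have e3 : 2 * k + d + 1 - 2 * k = d + 1 := by omega
    rw [e1, e2, e3, Nat.factorial_succ (2 * k + d + 1 + 1), Nat.factorial_succ (2 * k + d + 1),
      Nat.factorial_succ k, Nat.factorial_succ d]
    have h1 : (k.factorial : ℂ) ≠ 0 := by exact_mod_cast k.factorial_ne_zero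
    have h2 : (k : ℂ) + 1 ≠ 0 := by exact_mod_cast k.succ_ne_zero
    have h3 : (d.factorial : ℂ) ≠ 0 := by exact_mod_cast d.factorial_ne_zero
    have h4 : (d : ℂ) + 1 ≠ 0 := by exact_mod_cast d.succ_ne_zero
    push_cast
    field_simp
    ring

theorem hermiteH_zero (z : ℂ) : hermiteH 0 z = 1 := by simp [hermiteH]

theorem hermiteH_succ (m : ℕ) (z : ℂ) :
    hermiteH (m + 1) z = 2 * z * hermiteH m z - 2 * m * hermiteH (m - 1) z := by
  cases m with
  | zero => simp [hermiteH]
  | succ m =>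
    rw [hermiteH_eq_sum (N := m + 2) (by omega), hermiteH_eq_sum (N := m + 2) (by omega),
      hermiteH_eq_sum (m := m + 1 - 1) (N := m + 1) (by omega), Finset.sum_range_succ',
      Finset.sum_range_succ' (fun k => hermiteTerm (m + 1) k z), hermiteTerm_zero_succ, mul_add,
      Finset.mul_sum, Finset.mul_sum, Nat.add_sub_cancel]
    simp only [hermiteTerm_succ, Finset.sum_sub_distrib]
    push_cast
    ring

theorem hasDerivAt_hermiteH (m : ℕ) (z : ℂ) :
    HasDerivAt (hermiteH m) (2 * m * hermiteH (m - 1) z) z := by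
  induction m using Nat.strong_induction_on with
  | _ m ih =>
    match m with
    | 0 =>
      have : hermiteH 0 = fun _ => 1 := funext hermiteH_zero
      simpa [this] using hasDerivAt_const z (1 : ℂ)
    | 1 =>
      have : hermiteH 1 = fun z => 2 * z := funext fun z => by simp [hermiteH]
      rw [this]
      simpa [hermiteH_zero] using (hasDerivAt_id z).const_mul (2 : ℂ)
    | m + 2 =>
      have e : hermiteH (m + 2) =
          fun z => 2 * z * hermiteH (m + 1) z - 2 * (m + 1) * hermiteH m z := by
        funext z
        simpa using hermiteH_succ (m + 1) z
      have h1 := ih (m + 1) (by omega)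
      have h2 := ih m (by omega)
      rw [e]
      refine ((((hasDerivAt_id z).const_mul (2 : ℂ)).mul h1).sub
        (h2.const_mul (2 * (m + 1) : ℂ))).congr_deriv ?_
      simp only [Nat.add_sub_cancel, id, show m + 2 - 1 = m + 1 from rfl]
      have h3 := hermiteH_succ m z
      push_cast
      linear_combination (-2 * (m + 1) : ℂ) * h3

/-- The function `e^{a z²} H_m(z)`. -/
def gaussHermite (a : ℝ) (m : ℕ) : ℂ → ℂ := mulExp a (hermiteH m)

theorem gaussHermite_apply (a : ℝ) (m : ℕ) (z : ℂ) :
    gaussHermite a m z = Complex.exp (a * z ^ 2) * hermiteH m z := rfl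

theorem gaussHermite_zero (a : ℝ) : gaussHermite a 0 = gaussMonomial a 0 0 := by
  funext z
  simp [gaussHermite_apply, gaussMonomial, hermiteH_zero]

theorem gaussHermite_succ (a : ℝ) (m : ℕ) (z : ℂ) :
    gaussHermite a (m + 1) z =
      2 * z * gaussHermite a m z - 2 * m * gaussHermite a (m - 1) z := by
  simp only [gaussHermite_apply, hermiteH_succ]
  ring

theorem hasDerivAt_gaussHermite (a : ℝ) (m : ℕ) (z : ℂ) :
    HasDerivAt (gaussHermite a m)
      (2 * a * z * gaussHermite a m z + 2 * m * gaussHermite a (m - 1) z) z := by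
  refine ((hasDerivAt_cexp_mul_sq a z).mul (hasDerivAt_hermiteH m z)).congr_deriv ?_
  simp only [gaussHermite_apply]
  ring

theorem dz_gaussHermite (a : ℝ) (m : ℕ) (z : ℂ) :
    dz (gaussHermite a m) z = 2 * a * z * gaussHermite a m z + 2 * m * gaussHermite a (m - 1) z :=
  (HasDerivAt.hasWirtinger (hasDerivAt_gaussHermite a m z)).dz

theorem dzbar_gaussHermite (a : ℝ) (m : ℕ) : dzbar (gaussHermite a m) = 0 :=
  funext fun z => (HasDerivAt.hasWirtinger (hasDerivAt_gaussHermite a m z)).dzbar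

theorem gaussHermite_mem (a : ℝ) (m : ℕ) : gaussHermite a m ∈ gaussPoly a := by
  induction m using Nat.strong_induction_on with
  | _ m ih =>
    match m with
    | 0 => exact gaussHermite_zero a ▸ gaussMonomial_mem a 0 0
    | m + 1 =>
      have e : gaussHermite a (m + 1) = (2 : ℂ) • (fun z => z * gaussHermite a m z) -
          (2 * m : ℂ) • gaussHermite a (m - 1) := by
        funext z
        simp only [gaussHermite_succ, Pi.sub_apply, Pi.smul_apply, smul_eq_mul]
        ring
      rw [e]
      exact sub_mem (Submodule.smul_mem _ _ (mul_id_mem_gaussPoly (ih m (by omega))))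
        (Submodule.smul_mem _ _ (ih (m - 1) (by omega)))

section

variable {a ν : ℝ}

/-- On holomorphic functions `∂_z` is adjoint to multiplication by `ν z`. -/
theorem gaussPair_dz (ha : 0 ≤ a) (haν : 2 * a < ν) {u v : ℂ → ℂ} (hu : u ∈ gaussPoly a)
    (hv : v ∈ gaussPoly a) (hu' : dzbar u = 0) :
    gaussPair ν u (dz v) = ν * gaussPair ν (fun z => z * u z) v := by
  have h := gaussPair_nabla ha haν hu hv
  have h0 : gaussPair ν (dzbar u) v = 0 := by simp [hu', gaussPair]
  have e : dz v = (-1 : ℂ) • nabla ν 0 v + (ν : ℂ) • fun z => conj z * v z := by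
    rw [nabla_eq]
    module
  rw [e, gaussPair_add_right ha haν hu (Submodule.smul_mem _ _ (nabla_mem_gaussPoly ν hv))
    (Submodule.smul_mem _ _ (mul_conj_mem_gaussPoly hv)), gaussPair_smul_right,
    gaussPair_smul_right, h, h0, mul_zero, zero_add]
  congr 1
  refine integral_congr_ae (.of_forall fun z => ?_)
  simp only [map_mul]
  ring

/-- When `2a(2 + 2a) = ν²`, the raising operator `(2 + 2a) z - ∂_z`, which sends `e^{a z²} H_m` to
`e^{a z²} H_{m+1}`, is adjoint to a multiple of the lowering operator `∂_z - 2 a z`. -/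
theorem gaussPair_gaussHermite_succ (ha : 0 ≤ a) (haν : 2 * a < ν)
    (h : 2 * a * (2 + 2 * a) = ν ^ 2) (m l : ℕ) :
    gaussPair ν (gaussHermite a (m + 1)) (gaussHermite a l) =
      (2 + 2 * a) / ν * (2 * l) *
        gaussPair ν (gaussHermite a m) (gaussHermite a (l - 1)) := by
  have hν : (ν : ℂ) ≠ 0 := by
    have : 0 < ν := by linarith
    exact_mod_cast this.ne'
  have hm := gaussHermite_mem a m
  have hl := gaussHermite_mem a l
  have hl' := gaussHermite_mem a (l - 1)
  have e1 : gaussHermite a (m + 1) = (2 + 2 * a : ℂ) • (fun z => z * gaussHermite a m z) +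
      (-1 : ℂ) • dz (gaussHermite a m) := by
    funext z
    simp only [gaussHermite_succ, Pi.add_apply, Pi.smul_apply, smul_eq_mul, dz_gaussHermite]
    ring
  have e2 : dz (gaussHermite a l) = (2 * a : ℂ) • (fun z => z * gaussHermite a l z) +
      (2 * l : ℂ) • gaussHermite a (l - 1) := by
    funext z
    simp only [dz_gaussHermite, Pi.add_apply, Pi.smul_apply, smul_eq_mul]
    ring
  have h1 := gaussPair_dz ha haν hm hl (dzbar_gaussHermite a m)
  have h2 := gaussPair_dz ha haν hl hm (dzbar_gaussHermite a l)
  have h3 : gaussPair ν (dz (gaussHermite a m)) (gaussHermite a l) =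
      ν * gaussPair ν (gaussHermite a m) (fun z => z * gaussHermite a l z) := by
    rw [← conj_gaussPair, h2, map_mul, conj_gaussPair, conj_ofReal]
  rw [e2, gaussPair_add_right ha haν hm (Submodule.smul_mem _ _ (mul_id_mem_gaussPoly hl))
    (Submodule.smul_mem _ _ hl'), gaussPair_smul_right, gaussPair_smul_right] at h1
  rw [e1, gaussPair_add_left ha haν hl (Submodule.smul_mem _ _ (mul_id_mem_gaussPoly hm))
    (Submodule.smul_mem _ _ (dz_mem_gaussPoly hm)), gaussPair_smul_left, gaussPair_smul_left, h3]
  have hC : (2 * a * (2 + 2 * a) : ℂ) = ν ^ 2 := by exact_mod_cast h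
  have c1 : conj (2 + 2 * a : ℂ) = 2 + 2 * a := by
    rw [show (2 + 2 * a : ℂ) = ((2 + 2 * a : ℝ) : ℂ) by push_cast; ring, conj_ofReal]
  rw [c1]
  simp only [map_neg, map_one]
  field_simp
  linear_combination (-(2 + 2 * a) : ℂ) * h1 +
    gaussPair ν (gaussHermite a m) (fun z => z * gaussHermite a l z) * hC

theorem gaussPair_gaussHermite (ha : 0 ≤ a) (haν : 2 * a < ν)
    (h : 2 * a * (2 + 2 * a) = ν ^ 2) (m l : ℕ) :
    gaussPair ν (gaussHermite a m) (gaussHermite a l) =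
      if m = l then ((2 + 2 * a) / ν * 2) ^ m * m.factorial *
        gaussPair ν (gaussHermite a 0) (gaussHermite a 0) else 0 := by
  induction m generalizing l with
  | zero =>
    cases l with
    | zero => simp
    | succ l =>
      rw [← conj_gaussPair, gaussPair_gaussHermite_succ ha haν h]
      simp
  | succ m ih =>
    rw [gaussPair_gaussHermite_succ ha haν h]
    cases l with
    | zero => simp
    | succ l =>
      rw [Nat.add_sub_cancel, ih l]
      by_cases hml : m = l
      · subst hml
        simp only [if_true, Nat.factorial_succ]
        push_cast
        ring
      · simp [hml]

theorem gaussPair_gaussHermite_zero :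
    gaussPair ν (gaussHermite a 0) (gaussHermite a 0) =
      (√(Real.pi / (ν - 2 * a)) * √(Real.pi / (ν + 2 * a)) : ℝ) := by
  have e (z : ℂ) : conj (gaussHermite a 0 z) * gaussHermite a 0 z * gaussW ν z =
      (Real.exp (-(ν - 2 * a) * z.re ^ 2) * Real.exp (-(ν + 2 * a) * z.im ^ 2) : ℝ) := by
    rw [gaussHermite_apply, hermiteH_zero, mul_one, ← exp_conj, gaussW, ← Complex.exp_add,
      ← Complex.exp_add, ← Real.exp_add, ofReal_exp]
    congr 1
    apply Complex.ext <;> simp [pow_two] <;> ring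
  rw [gaussPair]
  simp_rw [e]
  rw [integral_complex_ofReal, ofReal_inj, ← Complex.volume_preserving_equiv_real_prod.symm.integral_comp
    Complex.measurableEquivRealProd.symm.measurableEmbedding]
  simp only [Complex.measurableEquivRealProd_symm_apply]
  rw [Measure.volume_eq_prod, integral_prod_mul (fun x : ℝ => Real.exp (-(ν - 2 * a) * x ^ 2))
    (fun y : ℝ => Real.exp (-(ν + 2 * a) * y ^ 2)), integral_gaussian, integral_gaussian]

/-! ### The iterated creation operator -/

/-- The function `(-∂_z + ν z̄)^n (e^{a z²} H_m)`. The first index `n` counts the creation operators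
and becomes the index of the eigenspace. -/
def creation (ν a : ℝ) (n m : ℕ) : ℂ → ℂ := (nabla ν 0)^[n] (gaussHermite a m)

theorem creation_zero (m : ℕ) : creation ν a 0 m = gaussHermite a m := rfl

theorem creation_succ (n m : ℕ) : creation ν a (n + 1) m = nabla ν 0 (creation ν a n m) := by
  rw [creation, Function.iterate_succ_apply', creation]

theorem creation_mem (n m : ℕ) : creation ν a n m ∈ gaussPoly a := by
  induction n with
  | zero => exact gaussHermite_mem a m
  | succ n ih => exact creation_succ (ν := ν) n m ▸ nabla_mem_gaussPoly ν ih

/-- The commutation relation `[∂_{z̄}, -∂_z + ν z̄] = ν`. -/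
theorem dzbar_nabla {f : ℂ → ℂ} (hf : ContDiff ℝ 2 f) :
    dzbar (nabla ν 0 f) = nabla ν 0 (dzbar f) + (ν : ℂ) • f := by
  funext z
  have h1 := ContDiff.hasWirtinger (contDiff_dz (m := 1) hf (by norm_num)) one_ne_zero z
  have h2 := ContDiff.hasWirtinger hf two_ne_zero z
  rw [nabla_eq]
  have h3 := h1.neg.add ((((hasWirtinger_conj z).mul h2)).const_mul (ν : ℂ))
  refine h3.dzbar.trans ?_
  simp only [nabla, Pi.add_apply, Pi.smul_apply, smul_eq_mul, dz_dzbar_comm hf, ofReal_zero]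
  ring

theorem dz_nabla {f : ℂ → ℂ} (hf : ContDiff ℝ 2 f) :
    dz (nabla ν 0 f) = nabla ν 0 (dz f) := by
  funext z
  have h1 := ContDiff.hasWirtinger (contDiff_dz (m := 1) hf (by norm_num)) one_ne_zero z
  have h2 := ContDiff.hasWirtinger hf two_ne_zero z
  have h3 := h1.neg.add ((((hasWirtinger_conj z).mul h2)).const_mul (ν : ℂ))
  conv_lhs => rw [nabla_eq]
  refine h3.dz.trans ?_
  simp only [nabla, ofReal_zero]
  ring

theorem nabla_mul_id {f : ℂ → ℂ} (hf : Differentiable ℝ f) :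
    nabla ν 0 (fun z => z * f z) = (fun z => z * nabla ν 0 f z) - f := by
  funext z
  have h := ((hasWirtinger_id z).mul (DifferentiableAt.hasWirtinger (hf z))).dz
  simp only [nabla, h, Pi.sub_apply, ofReal_zero]
  ring

theorem nabla_add {f g : ℂ → ℂ} (hf : Differentiable ℝ f) (hg : Differentiable ℝ g) :
    nabla ν 0 (f + g) = nabla ν 0 f + nabla ν 0 g := by
  funext z
  simp only [nabla, dz_add hf hg, Pi.add_apply]
  ring

theorem nabla_smul (c : ℂ) {f : ℂ → ℂ} (hf : Differentiable ℝ f) :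
    nabla ν 0 (c • f) = c • nabla ν 0 f := by
  funext z
  simp only [nabla, dz_smul c hf, Pi.smul_apply, smul_eq_mul]
  ring

theorem dzbar_creation_zero (m : ℕ) : dzbar (creation ν a 0 m) = 0 := dzbar_gaussHermite a m

theorem dzbar_creation_succ (n m : ℕ) :
    dzbar (creation ν a (n + 1) m) = ((n + 1) * ν : ℂ) • creation ν a n m := by
  induction n with
  | zero =>
    rw [creation_succ, dzbar_nabla (contDiff_of_mem_gaussPoly (creation_mem 0 m)),
      dzbar_creation_zero]
    funext z
    simp [nabla, dz]
  | succ n ih =>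
    rw [creation_succ, dzbar_nabla (contDiff_of_mem_gaussPoly (creation_mem (n + 1) m)), ih,
      nabla_smul _ (differentiable_of_mem_gaussPoly (creation_mem n m)), ← creation_succ]
    push_cast
    module

theorem magLaplacian_eq_nabla (f : ℂ → ℂ) (z : ℂ) :
    magLaplacian ν f z = nabla ν 0 (dzbar f) z := by
  simp [magLaplacian, nabla]

theorem magLaplacian_creation (n m : ℕ) (z : ℂ) :
    magLaplacian ν (creation ν a n m) z = n * ν * creation ν a n m z := by
  rw [magLaplacian_eq_nabla]
  cases n with
  | zero =>
    rw [dzbar_creation_zero]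
    simp [nabla, dz]
  | succ n =>
    rw [dzbar_creation_succ, nabla_smul _ (differentiable_of_mem_gaussPoly (creation_mem n m)),
      ← creation_succ]
    simp

theorem gaussPair_creation (ha : 0 ≤ a) (haν : 2 * a < ν) (n k m l : ℕ) :
    gaussPair ν (creation ν a n m) (creation ν a k l) =
      if n = k then ν ^ n * n.factorial * gaussPair ν (gaussHermite a m) (gaussHermite a l)
      else 0 := by
  induction n generalizing k with
  | zero =>
    cases k with
    | zero => simp [creation_zero]
    | succ k =>
      rw [creation_succ, gaussPair_nabla ha haν (creation_mem 0 m) (creation_mem k l),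
        dzbar_creation_zero]
      simp [gaussPair]
  | succ n ih =>
    cases k with
    | zero =>
      rw [← conj_gaussPair, creation_succ, gaussPair_nabla ha haν (creation_mem 0 l)
        (creation_mem n m), dzbar_creation_zero]
      simp [gaussPair]
    | succ k =>
      rw [creation_succ k, gaussPair_nabla ha haν (creation_mem (n + 1) m) (creation_mem k l),
        dzbar_creation_succ, gaussPair_smul_left, ih k]
      by_cases h : n = k
      · subst h
        simp only [if_true, Nat.factorial_succ, map_mul, map_add, map_one, conj_ofReal, map_natCast]
        push_cast
        ring
      · simp [h]

/-- The functions `(-∂_z + ν z̄)^n (e^{a z²} H_m)` span all products of `e^{a z²}` with a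
polynomial in `z` and `z̄`: their span is stable under multiplication by `z`, and under `∂_z`, hence
under multiplication by `z̄ = ν⁻¹ (∇ + ∂_z)`. -/
theorem gaussPoly_le_span_creation (hν : ν ≠ 0) :
    gaussPoly a ≤ Submodule.span ℂ (Set.range fun p : ℕ × ℕ => creation ν a p.1 p.2) := by
  set V := Submodule.span ℂ (Set.range fun p : ℕ × ℕ => creation ν a p.1 p.2) with hV
  have hν' : (ν : ℂ) ≠ 0 := by exact_mod_cast hν
  have hc (n m : ℕ) : creation ν a n m ∈ V := Submodule.subset_span ⟨(n, m), rfl⟩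
  have hVA : V ≤ gaussPoly a := by
    rw [hV, Submodule.span_le]
    rintro _ ⟨p, rfl⟩
    exact creation_mem p.1 p.2
  have hd {f : ℂ → ℂ} (hf : f ∈ V) : Differentiable ℝ f :=
    differentiable_of_mem_gaussPoly (hVA hf)
  have hnabla {f : ℂ → ℂ} (hf : f ∈ V) : nabla ν 0 f ∈ V := by
    induction hf using Submodule.span_induction with
    | mem x hx =>
      obtain ⟨p, rfl⟩ := hx
      exact creation_succ (ν := ν) p.1 p.2 ▸ hc _ _
    | zero =>
      convert zero_mem V using 1
      funext z
      simp [nabla, dz]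
    | add x y hx hy h1 h2 =>
      rw [nabla_add (hd hx) (hd hy)]
      exact add_mem h1 h2
    | smul c x hx h =>
      rw [nabla_smul c (hd hx)]
      exact V.smul_mem c h
  have hz0 (n m : ℕ) : (fun z => z * creation ν a n m z) ∈ V := by
    induction n with
    | zero =>
      have e : (fun z => z * creation ν a 0 m z) =
          (1 / 2 : ℂ) • creation ν a 0 (m + 1) + (m : ℂ) • creation ν a 0 (m - 1) := by
        funext z
        simp only [creation_zero, Pi.add_apply, Pi.smul_apply, smul_eq_mul, gaussHermite_succ]
        ring
      rw [e]
      exact add_mem (V.smul_mem _ (hc _ _)) (V.smul_mem _ (hc _ _))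
    | succ n ih =>
      have e : (fun z => z * creation ν a (n + 1) m z) =
          nabla ν 0 (fun z => z * creation ν a n m z) + creation ν a n m := by
        rw [nabla_mul_id (hd (hc n m)), creation_succ, sub_add_cancel]
      rw [e]
      exact add_mem (hnabla ih) (hc n m)
  have hdz0 (n m : ℕ) : dz (creation ν a n m) ∈ V := by
    induction n with
    | zero =>
      have e : dz (creation ν a 0 m) = (2 * a : ℂ) • (fun z => z * creation ν a 0 m z) +
          (2 * m : ℂ) • creation ν a 0 (m - 1) := by
        funext z
        simp only [creation_zero, Pi.add_apply, Pi.smul_apply, smul_eq_mul, dz_gaussHermite]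
        ring
      rw [e]
      exact add_mem (V.smul_mem _ (hz0 _ _)) (V.smul_mem _ (hc _ _))
    | succ n ih =>
      rw [creation_succ, dz_nabla (contDiff_of_mem_gaussPoly (creation_mem n m))]
      exact hnabla ih
  have hz {f : ℂ → ℂ} (hf : f ∈ V) : (fun z => z * f z) ∈ V := by
    induction hf using Submodule.span_induction with
    | mem x hx =>
      obtain ⟨p, rfl⟩ := hx
      exact hz0 _ _
    | zero =>
      convert zero_mem V using 1
      funext z
      simp
    | add x y hx hy h1 h2 =>
      convert add_mem h1 h2 using 1
      funext z
      simp [mul_add]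
    | smul c x hx h =>
      convert V.smul_mem c h using 1
      funext z
      simp [mul_left_comm]
  have hdz {f : ℂ → ℂ} (hf : f ∈ V) : dz f ∈ V := by
    induction hf using Submodule.span_induction with
    | mem x hx =>
      obtain ⟨p, rfl⟩ := hx
      exact hdz0 _ _
    | zero =>
      convert zero_mem V using 1
      funext z
      simp [dz]
    | add x y hx hy h1 h2 =>
      rw [dz_add (hd hx) (hd hy)]
      exact add_mem h1 h2
    | smul c x hx h =>
      rw [dz_smul c (hd hx)]
      exact V.smul_mem c h
  have hzbar {f : ℂ → ℂ} (hf : f ∈ V) : (fun z => conj z * f z) ∈ V := by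
    have e : (fun z => conj z * f z) = (1 / ν : ℂ) • (nabla ν 0 f + dz f) := by
      rw [nabla_eq]
      funext z
      simp [hν']
    rw [e]
    exact V.smul_mem _ (add_mem (hnabla hf) (hdz hf))
  rw [gaussPoly, Submodule.span_le]
  rintro _ ⟨⟨j, k⟩, rfl⟩
  change gaussMonomial a j k ∈ V
  induction k with
  | zero =>
    induction j with
    | zero => exact gaussHermite_zero a ▸ hc 0 0
    | succ j ih =>
      convert hz ih using 1
      funext z
      simp only [gaussMonomial]
      ring
  | succ k ih =>
    convert hzbar ih using 1
    funext z
    simp only [gaussMonomial]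
    ring

theorem nabla_mulExp (b : ℝ) {f : ℂ → ℂ} (hf : Differentiable ℝ f) :
    nabla ν 0 (mulExp b f) = mulExp b (nabla ν b f) := by
  funext z
  have h := ((HasDerivAt.hasWirtinger (hasDerivAt_cexp_mul_sq b z)).mul
    (DifferentiableAt.hasWirtinger (hf z))).dz
  have e : dz (mulExp b f) z = _ := h
  simp only [nabla, e]
  simp only [mulExp, LinearMap.coe_mk, AddHom.coe_mk, ofReal_zero, nabla]
  ring

theorem contDiff_nabla (b : ℝ) {f : ℂ → ℂ} (hf : ContDiff ℝ ∞ f) : ContDiff ℝ ∞ (nabla ν b f) := by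
  have h1 : ContDiff ℝ ∞ (dz f) := contDiff_dz hf (by simp)
  have h2 : ContDiff ℝ ∞ (fun z : ℂ => conj z) := conjCLE.contDiff
  unfold nabla
  fun_prop

theorem iterate_nabla_mulExp (b : ℝ) (n : ℕ) {f : ℂ → ℂ} (hf : ContDiff ℝ ∞ f) :
    (nabla ν 0)^[n] (mulExp b f) = mulExp b ((nabla ν b)^[n] f) := by
  induction n generalizing f with
  | zero => rfl
  | succ n ih =>
    rw [Function.iterate_succ_apply, nabla_mulExp b (hf.differentiable (by simp)),
      ih (contDiff_nabla b hf), Function.iterate_succ_apply]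

theorem contDiff_hermiteH (m : ℕ) : ContDiff ℝ ∞ (hermiteH m) := by
  unfold hermiteH
  fun_prop

end

/-! ### Determinacy of exponentially integrable functions by their moments -/

open scoped FourierTransform SchwartzMap InnerProductSpace in
/-- An integrable function whose Fourier transform vanishes is zero almost everywhere. -/
theorem ae_eq_zero_of_fourier_eq_zero {G : ℂ → ℂ} (hG : Integrable G)
    (h : ∀ w, 𝓕 G w = 0) : ∀ᵐ z, G z = 0 := by
  refine ae_eq_zero_of_integral_contDiff_smul_eq_zero hG.locallyIntegrable fun g hg hgc => ?_
  have hg₁ : HasCompactSupport (Complex.ofRealCLM ∘ g) := hgc.comp_left rfl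
  have hg₂ : ContDiff ℝ ∞ (Complex.ofRealCLM ∘ g) := Complex.ofRealCLM.contDiff.comp hg
  set φ : 𝓢(ℂ, ℂ) := hg₁.toSchwartzMap hg₂ with hφ
  set ψ : 𝓢(ℂ, ℂ) := 𝓕⁻ φ with hψ
  have e1 : 𝓕 (ψ : ℂ → ℂ) = φ := by
    rw [← SchwartzMap.fourier_coe, hψ, FourierTransform.fourier_fourierInv_eq]
  have e2 : ∫ z, g z • G z = ∫ z, (𝓕 (ψ : ℂ → ℂ)) z • G z := by
    rw [e1]
    refine integral_congr_ae (.of_forall fun z => ?_)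
    simp [hφ]
  have e3 := VectorFourier.integral_fourierIntegral_smul_eq_flip (L := innerₗ ℂ)
    Real.continuous_fourierChar continuous_inner ψ.integrable hG (μ := volume) (ν := volume)
  rw [e2]
  have e4 : ∫ z, (𝓕 (ψ : ℂ → ℂ)) z • G z = ∫ z, ψ z • 𝓕 G z := by
    convert e3 using 1
    · rfl
    · rw [flip_innerₗ]
      rfl
  rw [e4]
  simp [h]

theorem integrable_pow_mul {G : ℂ → ℂ} (hm : AEStronglyMeasurable G)
    (hG : ∀ c : ℝ, Integrable fun z => Real.exp (c * ‖z‖) * ‖G z‖) (j k : ℕ) :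
    Integrable fun z => z ^ j * conj z ^ k * G z := by
  have hc : Continuous fun z : ℂ => z ^ j * conj z ^ k :=
    (continuous_pow j).mul (Complex.continuous_conj.pow k)
  refine ((hG 1).const_mul (j + k).factorial).mono' (hc.aestronglyMeasurable.mul hm)
    (.of_forall fun z => ?_)
  have h := Real.pow_div_factorial_le_exp ‖z‖ (norm_nonneg z) (j + k)
  rw [div_le_iff₀ (by positivity)] at h
  simp only [norm_mul, norm_pow, RCLike.norm_conj, one_mul]
  rw [← pow_add, ← mul_assoc]
  gcongr
  linarith

open scoped FourierTransform InnerProductSpace in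
/-- If all exponential moments of `G` are finite and all moments `∫ z^j z̄^k G` vanish, then `G = 0`
almost everywhere: the Fourier transform of `G` is the sum of its moment series. -/
theorem ae_eq_zero_of_moments_eq_zero {G : ℂ → ℂ} (hm : AEStronglyMeasurable G)
    (hG : ∀ c : ℝ, Integrable fun z => Real.exp (c * ‖z‖) * ‖G z‖)
    (h : ∀ j k : ℕ, ∫ z, z ^ j * conj z ^ k * G z = 0) : ∀ᵐ z, G z = 0 := by
  have hint : Integrable G := by
    simpa using integrable_pow_mul hm hG 0 0
  refine ae_eq_zero_of_fourier_eq_zero hint fun w => ?_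
  rw [Real.fourier_eq']
  set A : ℂ := -(Real.pi * I * w)
  set B : ℂ := -(Real.pi * I * conj w)
  have hx (v : ℂ) : ((-2 * Real.pi * ⟪v, w⟫_ℝ : ℝ) : ℂ) * I = A * conj v + B * v := by
    have : ((⟪v, w⟫_ℝ : ℝ) : ℂ) = (w * conj v + conj w * v) / 2 := by
      rw [Complex.inner, re_eq_add_conj]
      simp only [map_mul, conj_conj]
    push_cast
    rw [this]
    simp only [A, B]
    ring
  have hxn (v : ℂ) : ‖A * conj v + B * v‖ ≤ 2 * Real.pi * ‖w‖ * ‖v‖ := by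
    rw [← hx, norm_mul, norm_I, mul_one, norm_real, Real.norm_eq_abs, abs_mul, abs_mul, abs_neg,
      abs_of_pos Real.pi_pos, abs_two]
    have := abs_real_inner_le_norm v w
    nlinarith [Real.pi_pos]
  have hzero (n : ℕ) : ∫ v, (A * conj v + B * v) ^ n / (n.factorial : ℂ) * G v = 0 := by
    have e (v : ℂ) : (A * conj v + B * v) ^ n / (n.factorial : ℂ) * G v =
        ∑ k ∈ Finset.range (n + 1), A ^ k * B ^ (n - k) * (n.choose k) / (n.factorial : ℂ) *
          (v ^ (n - k) * conj v ^ k * G v) := by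
      rw [add_pow, Finset.sum_div, Finset.sum_mul]
      refine Finset.sum_congr rfl fun k _ => ?_
      rw [mul_pow, mul_pow]
      ring
    simp_rw [e]
    rw [integral_finsetSum _ fun k _ => (integrable_pow_mul hm hG _ _).const_mul _]
    simp_rw [integral_const_mul, h]
    simp
  have hsum := hasSum_integral_of_dominated_convergence (μ := (volume : Measure ℂ))
    (F := fun n v => (A * conj v + B * v) ^ n / (n.factorial : ℂ) * G v)
    (f := fun v => Complex.exp (A * conj v + B * v) * G v)
    (fun n v => (2 * Real.pi * ‖w‖ * ‖v‖) ^ n / (n.factorial : ℝ) * ‖G v‖) ?_ ?_ ?_ ?_ ?_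
  · simp_rw [hzero] at hsum
    simp_rw [hx, smul_eq_mul]
    exact hsum.unique hasSum_zero
  · intro n
    have hc : Continuous fun v : ℂ => (A * conj v + B * v) ^ n / (n.factorial : ℂ) := by
      have := Complex.continuous_conj
      fun_prop
    exact hc.aestronglyMeasurable.mul hm
  · refine fun n => .of_forall fun v => ?_
    rw [norm_mul, norm_div, norm_pow, Complex.norm_natCast]
    gcongr
    exact hxn v
  · exact .of_forall fun v => (Real.summable_pow_div_factorial _).mul_right _
  · refine (hG (2 * Real.pi * ‖w‖)).congr (.of_forall fun v => ?_)
    simp only []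
    rw [tsum_mul_right, Real.exp_eq_exp_ℝ, NormedSpace.exp_eq_tsum_div]
  · refine .of_forall fun v => HasSum.mul_right _ ?_
    rw [Complex.exp_eq_exp_ℂ]
    exact NormedSpace.expSeries_div_hasSum_exp _

/-! ### Symmetry of the magnetic Laplacian -/

theorem continuous_dz_dzbar {f : ℂ → ℂ} (hf : ContDiff ℝ 1 f) :
    Continuous (dz f) ∧ Continuous (dzbar f) :=
  ⟨(contDiff_dz (m := 0) hf (by norm_num)).continuous,
    (contDiff_dzbar (m := 0) hf (by norm_num)).continuous⟩

theorem integral_mul_dz_of_hasCompactSupport {u v : ℂ → ℂ} (hu : ContDiff ℝ 1 u)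
    (hv : ContDiff ℝ 1 v) (hc : HasCompactSupport u) :
    ∫ z, u z * dz v z = -∫ z, dz u z * v z := by
  have hu' := hu.continuous_fderiv one_ne_zero
  have hv' := hv.continuous_fderiv one_ne_zero
  have h1 : HasCompactSupport fun z => fderiv ℝ u z 1 :=
    (hc.fderiv (𝕜 := ℝ)).comp_left (g := fun L : ℂ →L[ℝ] ℂ => L 1) rfl
  have h2 : HasCompactSupport fun z => fderiv ℝ u z I :=
    (hc.fderiv (𝕜 := ℝ)).comp_left (g := fun L : ℂ →L[ℝ] ℂ => L I) rfl
  have := hu.continuous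
  have := hv.continuous
  refine integral_mul_dz (hu.differentiable one_ne_zero) (hv.differentiable one_ne_zero)
    ?_ ?_ ?_ ?_ ?_
  · exact Continuous.integrable_of_hasCompactSupport (by fun_prop) hc.mul_right
  · exact Continuous.integrable_of_hasCompactSupport (by fun_prop) h1.mul_right
  · exact Continuous.integrable_of_hasCompactSupport (by fun_prop) h2.mul_right
  · exact Continuous.integrable_of_hasCompactSupport (by fun_prop) hc.mul_right
  · exact Continuous.integrable_of_hasCompactSupport (by fun_prop) hc.mul_right

theorem integral_mul_dzbar_of_hasCompactSupport {u v : ℂ → ℂ} (hu : ContDiff ℝ 1 u)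
    (hv : ContDiff ℝ 1 v) (hc : HasCompactSupport u) :
    ∫ z, u z * dzbar v z = -∫ z, dzbar u z * v z := by
  have hu' := hu.continuous_fderiv one_ne_zero
  have hv' := hv.continuous_fderiv one_ne_zero
  have h1 : HasCompactSupport fun z => fderiv ℝ u z 1 :=
    (hc.fderiv (𝕜 := ℝ)).comp_left (g := fun L : ℂ →L[ℝ] ℂ => L 1) rfl
  have h2 : HasCompactSupport fun z => fderiv ℝ u z I :=
    (hc.fderiv (𝕜 := ℝ)).comp_left (g := fun L : ℂ →L[ℝ] ℂ => L I) rfl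
  have := hu.continuous
  have := hv.continuous
  refine integral_mul_dzbar (hu.differentiable one_ne_zero) (hv.differentiable one_ne_zero)
    ?_ ?_ ?_ ?_ ?_
  · exact Continuous.integrable_of_hasCompactSupport (by fun_prop) hc.mul_right
  · exact Continuous.integrable_of_hasCompactSupport (by fun_prop) h1.mul_right
  · exact Continuous.integrable_of_hasCompactSupport (by fun_prop) h2.mul_right
  · exact Continuous.integrable_of_hasCompactSupport (by fun_prop) hc.mul_right
  · exact Continuous.integrable_of_hasCompactSupport (by fun_prop) hc.mul_right

theorem hasCompactSupport_dz {u : ℂ → ℂ} (hc : HasCompactSupport u) : HasCompactSupport (dz u) :=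
  (hc.fderiv (𝕜 := ℝ)).comp_left (g := fun L : ℂ →L[ℝ] ℂ => (L 1 - I * L I) / 2) (by simp)

theorem hasCompactSupport_dzbar {u : ℂ → ℂ} (hc : HasCompactSupport u) :
    HasCompactSupport (dzbar u) :=
  (hc.fderiv (𝕜 := ℝ)).comp_left (g := fun L : ℂ →L[ℝ] ℂ => (L 1 + I * L I) / 2) (by simp)

/-- The transpose of the magnetic Laplacian for the weight `e^{-ν|z|²}`, tested against a compactly
supported function. -/
theorem integral_magLaplacian_mul {ν : ℝ} {g H : ℂ → ℂ} (hg : ContDiff ℝ 2 g)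
    (hH : ContDiff ℝ 2 H) (hc : HasCompactSupport H) :
    ∫ z, magLaplacian ν g z * H z * gaussW ν z =
      ∫ z, g z * (-dzbar (dz H) z + ν * z * dz H z) * gaussW ν z := by
  have hW1 : ContDiff ℝ 1 (gaussW ν) := contDiff_gaussW ν
  have hg1 : ContDiff ℝ 1 (dzbar g) := contDiff_dzbar hg (by norm_num)
  have hH1 : ContDiff ℝ 1 (dz H) := contDiff_dz hH (by norm_num)
  have hH1' : ContDiff ℝ 1 H := hH.of_le (by norm_num)
  have hcd := hasCompactSupport_dz hc
  have e1 := integral_mul_dz_of_hasCompactSupport (u := fun z => H z * gaussW ν z)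
    (hH1'.mul hW1) hg1 hc.mul_right
  have e2 := integral_mul_dzbar_of_hasCompactSupport (u := fun z => dz H z * gaussW ν z)
    (hH1.mul hW1) (hg.of_le (by norm_num)) hcd.mul_right
  have d1 (z : ℂ) : dz (fun z => H z * gaussW ν z) z =
      (dz H z - ν * conj z * H z) * gaussW ν z := by
    rw [((ContDiff.hasWirtinger hH two_ne_zero z).mul (hasWirtinger_gaussW ν z)).dz]
    ring
  have d2 (z : ℂ) : dzbar (fun z => dz H z * gaussW ν z) z =
      (dzbar (dz H) z - ν * z * dz H z) * gaussW ν z := by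
    rw [((ContDiff.hasWirtinger hH1 one_ne_zero z).mul (hasWirtinger_gaussW ν z)).dzbar]
    ring
  have hcont := hW1.continuous
  have hcont1 := hg1.continuous
  have hcont2 := hH1.continuous
  have hcont3 := hH.continuous
  have hcont4 := Complex.continuous_conj
  have hcont5 := (continuous_dz_dzbar hg1).1
  calc ∫ z, magLaplacian ν g z * H z * gaussW ν z
      = -(∫ z, H z * gaussW ν z * dz (dzbar g) z) +
          ∫ z, ν * conj z * dzbar g z * H z * gaussW ν z := by
        rw [← integral_neg, ← integral_add]
        · refine integral_congr_ae (.of_forall fun z => ?_)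
          simp only [magLaplacian]
          ring
        · exact (Continuous.integrable_of_hasCompactSupport (by fun_prop)
            hc.mul_right.mul_right).neg
        · exact Continuous.integrable_of_hasCompactSupport (by fun_prop)
            (hc.mul_left.mul_right)
    _ = ∫ z, dz H z * gaussW ν z * dzbar g z := by
        rw [e1, neg_neg, ← integral_add]
        · refine integral_congr_ae (.of_forall fun z => ?_)
          simp only [d1]
          ring
        · refine Continuous.integrable_of_hasCompactSupport ?_
            (hasCompactSupport_dz hc.mul_right).mul_right
          simp_rw [d1]
          fun_prop
        · exact Continuous.integrable_of_hasCompactSupport (by fun_prop)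
            (hc.mul_left.mul_right)
    _ = _ := by
        rw [e2, ← integral_neg]
        refine integral_congr_ae (.of_forall fun z => ?_)
        simp only [d2]
        ring

theorem integrable_transpose_magLaplacian {ν : ℝ} {g H : ℂ → ℂ} (hg : Continuous g)
    (hH : ContDiff ℝ 2 H) (hc : HasCompactSupport H) :
    Integrable fun z => g z * (-dzbar (dz H) z + ν * z * dz H z) * gaussW ν z := by
  have hH1 : ContDiff ℝ 1 (dz H) := contDiff_dz hH (by norm_num)
  have h1 := hH1.continuous
  have h2 := (continuous_dz_dzbar hH1).2
  have h3 := (contDiff_gaussW ν (n := 0)).continuous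
  have hcd := hasCompactSupport_dz hc
  exact Continuous.integrable_of_hasCompactSupport (by fun_prop)
    (((hasCompactSupport_dzbar hcd).neg.add hcd.mul_left).mul_left.mul_right)

theorem HasWirtinger.comp_mul_left {f : ℂ → ℂ} {p q z : ℂ} (ε : ℝ)
    (h : HasWirtinger f p q (ε * z)) :
    HasWirtinger (fun w => f (ε * w)) (ε * p) (ε * q) z := by
  have h1 : HasFDerivAt (fun w : ℂ => (ε : ℂ) * w) ((ε : ℂ) • (1 : ℂ →L[ℝ] ℂ)) z :=
    (hasFDerivAt_id (𝕜 := ℝ) z).const_mul (ε : ℂ)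
  have h2 : HasFDerivAt f (p • (1 : ℂ →L[ℝ] ℂ) + q • (conjCLE : ℂ →L[ℝ] ℂ)) ((ε : ℂ) * z) := h
  refine (h2.comp z h1).congr_fderiv ?_
  ext v
  simp
  ring

/-- A smooth cutoff function, equal to one on the unit ball. -/
def cutoff (z : ℂ) : ℂ := ((⟨1, 2, one_pos, one_lt_two⟩ : ContDiffBump (0 : ℂ)) z : ℝ)

theorem contDiff_cutoff {n : ℕ∞} : ContDiff ℝ n cutoff :=
  Complex.ofRealCLM.contDiff.comp (ContDiffBump.contDiff _)

theorem hasCompactSupport_cutoff : HasCompactSupport cutoff :=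
  (ContDiffBump.hasCompactSupport _).comp_left (g := fun x : ℝ => (x : ℂ)) rfl

theorem cutoff_eq_one {z : ℂ} (hz : ‖z‖ ≤ 1) : cutoff z = 1 := by
  rw [cutoff, ContDiffBump.one_of_mem_closedBall _ (by simpa using hz), ofReal_one]

theorem norm_cutoff_le (z : ℂ) : ‖cutoff z‖ ≤ 1 := by
  rw [cutoff, norm_real, Real.norm_of_nonneg (ContDiffBump.nonneg _)]
  exact ContDiffBump.le_one _

theorem exists_bound_cutoff : ∃ M : ℝ, 0 ≤ M ∧ (∀ z, ‖dz cutoff z‖ ≤ M) ∧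
    (∀ z, ‖dzbar cutoff z‖ ≤ M) ∧ ∀ z, ‖dzbar (dz cutoff) z‖ ≤ M := by
  have h2 : ContDiff ℝ 1 (dz cutoff) :=
    contDiff_dz (n := 2) (contDiff_cutoff (n := 2)) (by norm_num)
  have h1 : ContDiff ℝ 1 cutoff := contDiff_cutoff (n := 1)
  have c := hasCompactSupport_cutoff
  obtain ⟨A, hA⟩ := (continuous_dz_dzbar h1).1.bounded_above_of_compact_support
    (hasCompactSupport_dz c)
  obtain ⟨B, hB⟩ := (continuous_dz_dzbar h1).2.bounded_above_of_compact_support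
    (hasCompactSupport_dzbar c)
  obtain ⟨C, hC⟩ := (continuous_dz_dzbar h2).2.bounded_above_of_compact_support
    (hasCompactSupport_dzbar (hasCompactSupport_dz c))
  have hA0 := (norm_nonneg _).trans (hA 0)
  have hB0 := (norm_nonneg _).trans (hB 0)
  have hC0 := (norm_nonneg _).trans (hC 0)
  exact ⟨A + B + C, by positivity, fun z => (hA z).trans (by linarith),
    fun z => (hB z).trans (by linarith), fun z => (hC z).trans (by linarith)⟩

/-- Eigenfunctions of the magnetic Laplacian for distinct eigenvalues are orthogonal. One of them
is only assumed to be of class `C²` and square integrable, with no control of its derivatives;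
they are all moved to the other one with the help of the cutoff functions `z ↦ χ(ε z)`, whose
derivatives are `O(ε)`. -/
theorem gaussPair_eq_zero_of_magLaplacian {ν a μ κ : ℝ} {g u : ℂ → ℂ}
    (hg : ContDiff ℝ 2 g)
    (hint : ∀ h ∈ gaussPoly a, Integrable fun z => conj (h z) * g z * gaussW ν z)
    (hgμ : ∀ z, magLaplacian ν g z = μ * g z) (hu : u ∈ gaussPoly a)
    (huκ : ∀ z, magLaplacian ν u z = κ * u z) (hne : μ ≠ κ) : gaussPair ν u g = 0 := by
  obtain ⟨M, hM0, hM1, hM2, hM3⟩ := exists_bound_cutoff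
  have hdu := dz_mem_gaussPoly hu
  have hdu' := dzbar_mem_gaussPoly hu
  have hzu : (fun z => conj z * u z) ∈ gaussPoly a := mul_conj_mem_gaussPoly hu
  set Φ : ℂ → ℝ := fun z => ‖conj (u z) * g z * gaussW ν z‖ +
    ‖conj (dz u z) * g z * gaussW ν z‖ + ‖conj (dzbar u z) * g z * gaussW ν z‖ +
    |ν| * ‖conj (conj z * u z) * g z * gaussW ν z‖ with hΦ
  have hΦi : Integrable Φ :=
    (((hint u hu).norm.add (hint _ hdu).norm).add (hint _ hdu').norm).add
      ((hint _ hzu).norm.const_mul _)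
  -- the functions `χ(ε z)` and `conj u`, and their Wirtinger derivatives
  have hχd {n : ℕ∞} (ε : ℝ) : ContDiff ℝ n fun z : ℂ => cutoff (ε * z) :=
    contDiff_cutoff.comp (contDiff_const.mul contDiff_id)
  have hχ (ε : ℝ) (z : ℂ) : HasWirtinger (fun z : ℂ => cutoff (ε * z))
      (ε * dz cutoff (ε * z)) (ε * dzbar cutoff (ε * z)) z :=
    HasWirtinger.comp_mul_left ε (ContDiff.hasWirtinger (contDiff_cutoff (n := 1)) one_ne_zero _)
  have hχ2 (ε : ℝ) (z : ℂ) : HasWirtinger (fun z : ℂ => ε * dz cutoff (ε * z))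
      (ε * (ε * dz (dz cutoff) (ε * z))) (ε * (ε * dzbar (dz cutoff) (ε * z))) z :=
    (HasWirtinger.comp_mul_left ε (ContDiff.hasWirtinger (n := 1)
      (contDiff_dz (n := 2) (contDiff_cutoff (n := 2)) (by norm_num)) one_ne_zero _)).const_mul _
  have hv (z : ℂ) : HasWirtinger (fun z => conj (u z)) (conj (dzbar u z)) (conj (dz u z)) z :=
    (DifferentiableAt.hasWirtinger (differentiable_of_mem_gaussPoly hu z)).star
  have hv2 (z : ℂ) : HasWirtinger (fun z => conj (dzbar u z)) (conj (dzbar (dzbar u) z))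
      (conj (dz (dzbar u) z)) z :=
    (DifferentiableAt.hasWirtinger (differentiable_of_mem_gaussPoly hdu' z)).star
  have key (ε : ℝ) (hε0 : 0 < ε) (hε1 : ε ≤ 1) :
      ‖((μ - κ : ℝ) : ℂ) * ∫ z, conj (u z) * g z * gaussW ν z * cutoff (ε * z)‖ ≤
        ε * (M * ∫ z, Φ z) := by
    have hdzH : dz (fun z => cutoff (ε * z) * conj (u z)) = fun z =>
        ε * dz cutoff (ε * z) * conj (u z) + cutoff (ε * z) * conj (dzbar u z) :=
      funext fun z => ((hχ ε z).mul (hv z)).dz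
    have hHc : HasCompactSupport fun z => cutoff (ε * z) * conj (u z) := by
      refine HasCompactSupport.mul_right ?_
      have hε : (ε : ℂ) ≠ 0 := by exact_mod_cast hε0.ne'
      exact hasCompactSupport_cutoff.comp_homeomorph (Homeomorph.mulLeft₀ (ε : ℂ) hε)
    have hHd : ContDiff ℝ 2 fun z => cutoff (ε * z) * conj (u z) :=
      (hχd (n := 2) ε).mul (conjCLE.contDiff.comp (contDiff_of_mem_gaussPoly hu))
    have hH := integral_magLaplacian_mul (ν := ν) hg hHd hHc
    have iH := integrable_transpose_magLaplacian (ν := ν) hg.continuous hHd hHc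
    have hT (z : ℂ) : -dzbar (dz fun z => cutoff (ε * z) * conj (u z)) z +
        ν * z * dz (fun z => cutoff (ε * z) * conj (u z)) z =
        κ * (cutoff (ε * z) * conj (u z)) +
        ε * (-(ε * dzbar (dz cutoff) (ε * z)) * conj (u z) - dz cutoff (ε * z) * conj (dz u z)
          - dzbar cutoff (ε * z) * conj (dzbar u z) +
          ν * dz cutoff (ε * z) * (z * conj (u z))) := by
      rw [hdzH]
      beta_reduce
      rw [(((hχ2 ε z).mul (hv z)).add ((hχ ε z).mul (hv2 z))).dzbar]
      have h := congrArg conj (huκ z)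
      simp only [magLaplacian, map_add, map_neg, map_mul, conj_ofReal, conj_conj] at h
      linear_combination cutoff (ε * z) * h
    have hcχ := (hχd (n := 0) ε).continuous
    have i1 : Integrable fun z => conj (u z) * g z * gaussW ν z * cutoff (ε * z) := by
      refine (hint u hu).mul_bdd (c := 1) hcχ.aestronglyMeasurable
        (.of_forall fun z => norm_cutoff_le _)
    simp_rw [hT, hgμ] at hH
    simp_rw [hT] at iH
    have e1 : ((μ - κ : ℝ) : ℂ) * ∫ z, conj (u z) * g z * gaussW ν z * cutoff (ε * z) =
        ∫ z, ε * (-(ε * dzbar (dz cutoff) (ε * z)) * (conj (u z) * g z * gaussW ν z)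
          - dz cutoff (ε * z) * (conj (dz u z) * g z * gaussW ν z)
          - dzbar cutoff (ε * z) * (conj (dzbar u z) * g z * gaussW ν z) +
          ν * dz cutoff (ε * z) * (conj (conj z * u z) * g z * gaussW ν z)) := by
      have l : ∫ z, μ * g z * (cutoff (ε * z) * conj (u z)) * gaussW ν z =
          μ * ∫ z, conj (u z) * g z * gaussW ν z * cutoff (ε * z) := by
        rw [← integral_const_mul]
        refine integral_congr_ae (.of_forall fun z => ?_)
        simp only []
        ring
      rw [l] at hH
      push_cast
      rw [sub_mul, hH, ← integral_const_mul, ← integral_sub]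
      · refine integral_congr_ae (.of_forall fun z => ?_)
        simp only [map_mul, conj_conj]
        ring
      · exact iH
      · exact i1.const_mul _
    rw [e1, ← integral_const_mul, ← integral_const_mul]
    refine norm_integral_le_of_norm_le ((hΦi.const_mul _).const_mul _) (.of_forall fun z => ?_)
    rw [norm_mul, norm_real, Real.norm_of_nonneg hε0.le]
    refine mul_le_mul_of_nonneg_left ?_ hε0.le
    have b3 : ‖-(ε * dzbar (dz cutoff) (ε * z))‖ ≤ M := by
      rw [norm_neg, norm_mul, norm_real, Real.norm_of_nonneg hε0.le]
      calc ε * ‖dzbar (dz cutoff) (ε * z)‖ ≤ 1 * ‖dzbar (dz cutoff) (ε * z)‖ := by gcongr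
        _ ≤ M := by simpa using hM3 _
    have b1 := hM1 (ε * z)
    have b2 := hM2 (ε * z)
    refine (norm_add_le _ _).trans ?_
    have t1 := norm_sub_le (-(ε * dzbar (dz cutoff) (ε * z)) * (conj (u z) * g z * gaussW ν z)
          - dz cutoff (ε * z) * (conj (dz u z) * g z * gaussW ν z))
          (dzbar cutoff (ε * z) * (conj (dzbar u z) * g z * gaussW ν z))
    have t2 := norm_sub_le (-(ε * dzbar (dz cutoff) (ε * z)) * (conj (u z) * g z * gaussW ν z))
          (dz cutoff (ε * z) * (conj (dz u z) * g z * gaussW ν z))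
    rw [norm_mul (-(ε * dzbar (dz cutoff) (ε * z))), norm_mul (dz cutoff (ε * z))] at t2
    rw [norm_mul (dzbar cutoff (ε * z))] at t1
    rw [norm_mul (ν * dz cutoff (ε * z)), norm_mul (ν : ℂ), norm_real, Real.norm_eq_abs]
    have m1 := mul_le_mul_of_nonneg_right b3 (norm_nonneg (conj (u z) * g z * gaussW ν z))
    have m2 := mul_le_mul_of_nonneg_right b1 (norm_nonneg (conj (dz u z) * g z * gaussW ν z))
    have m3 := mul_le_mul_of_nonneg_right b2 (norm_nonneg (conj (dzbar u z) * g z * gaussW ν z))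
    have m4 := mul_le_mul_of_nonneg_left (mul_le_mul_of_nonneg_right b1
      (norm_nonneg (conj (conj z * u z) * g z * gaussW ν z))) (abs_nonneg ν)
    simp only [hΦ]
    linarith
  -- the limit `ε → 0`
  have hlim : Filter.Tendsto
      (fun N : ℕ => ∫ z, conj (u z) * g z * gaussW ν z * cutoff ((1 / ((N : ℝ) + 1) : ℝ) * z))
      Filter.atTop (nhds (∫ z, conj (u z) * g z * gaussW ν z)) := by
    refine tendsto_integral_of_dominated_convergence
      (fun z => ‖conj (u z) * g z * gaussW ν z‖) (fun N => ?_) (hint u hu).norm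
      (fun N => .of_forall fun z => ?_) (.of_forall fun z => ?_)
    · exact (hint u hu).aestronglyMeasurable.mul
        ((hχd (n := 0) _).continuous).aestronglyMeasurable
    · rw [norm_mul]
      exact mul_le_of_le_one_right (norm_nonneg _) (norm_cutoff_le _)
    · refine tendsto_const_nhds.congr' ?_
      obtain ⟨N₀, hN₀⟩ := exists_nat_ge ‖z‖
      filter_upwards [Filter.eventually_ge_atTop N₀] with N hN
      rw [cutoff_eq_one, mul_one]
      have : (N₀ : ℝ) ≤ N := by exact_mod_cast hN
      rw [norm_mul, norm_real, Real.norm_of_nonneg (by positivity), one_div_mul_eq_div,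
        div_le_one (by positivity)]
      linarith
  have hz : Filter.Tendsto (fun N : ℕ => (1 / ((N : ℝ) + 1)) * (M * ∫ z, Φ z))
      Filter.atTop (nhds 0) := by
    simpa using tendsto_one_div_add_atTop_nhds_zero_nat.mul_const (M * ∫ z, Φ z)
  have h0 := squeeze_zero_norm (fun N : ℕ => key (1 / ((N : ℝ) + 1)) (by positivity)
    (by rw [div_le_one (by positivity)]; linarith [(Nat.cast_nonneg N : (0 : ℝ) ≤ N)])) hz
  have h1 := tendsto_nhds_unique (hlim.const_mul ((μ - κ : ℝ) : ℂ)) h0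
  have h2 : ((μ - κ : ℝ) : ℂ) ≠ 0 := by exact_mod_cast sub_ne_zero.mpr hne
  exact (mul_eq_zero.mp h1).resolve_left h2

/-! ### Square integrable functions for a continuous weight -/

theorem ae_withDensity_ofReal {ρ : ℂ → ℝ} (hρ : Continuous ρ) (hpos : ∀ z, 0 < ρ z) :
    ae ((volume : Measure ℂ).withDensity fun z => ENNReal.ofReal (ρ z)) = ae volume := by
  refine le_antisymm (withDensity_absolutelyContinuous _ _).ae_le
    (withDensity_absolutelyContinuous' ?_ ?_).ae_le
  · exact hρ.measurable.ennreal_ofReal.aemeasurable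
  · exact .of_forall fun z => by simpa using hpos z

theorem integrable_withDensity_ofReal {E : Type*} [NormedAddCommGroup E] [NormedSpace ℝ E]
    {ρ : ℂ → ℝ} (hρ : Continuous ρ) (hpos : ∀ z, 0 < ρ z) {f : ℂ → E} :
    Integrable f ((volume : Measure ℂ).withDensity fun z => ENNReal.ofReal (ρ z)) ↔
      Integrable fun z => ρ z • f z := by
  rw [integrable_withDensity_iff_integrable_smul' hρ.measurable.ennreal_ofReal
    (.of_forall fun z => ENNReal.ofReal_lt_top)]
  simp only [ENNReal.toReal_ofReal (hpos _).le]

theorem integral_withDensity_ofReal {E : Type*} [NormedAddCommGroup E] [NormedSpace ℝ E]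
    {ρ : ℂ → ℝ} (hρ : Continuous ρ) (hpos : ∀ z, 0 < ρ z) (f : ℂ → E) :
    ∫ z, f z ∂((volume : Measure ℂ).withDensity fun z => ENNReal.ofReal (ρ z)) =
      ∫ z, ρ z • f z := by
  rw [integral_withDensity_eq_integral_toReal_smul hρ.measurable.ennreal_ofReal
    (.of_forall fun z => ENNReal.ofReal_lt_top)]
  simp only [ENNReal.toReal_ofReal (hpos _).le]

theorem memLp_two_withDensity_iff {ρ : ℂ → ℝ} (hρ : Continuous ρ) (hpos : ∀ z, 0 < ρ z)
    {f : ℂ → ℂ} :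
    MemLp f 2 ((volume : Measure ℂ).withDensity fun z => ENNReal.ofReal (ρ z)) ↔
      AEStronglyMeasurable f ∧ Integrable fun z => ρ z * ‖f z‖ ^ 2 := by
  have hae := ae_withDensity_ofReal hρ hpos
  have hm : AEStronglyMeasurable f
      ((volume : Measure ℂ).withDensity fun z => ENNReal.ofReal (ρ z)) ↔
      AEStronglyMeasurable f := by
    refine ⟨fun h => h.mono_ac ?_, fun h => h.mono_ac ?_⟩
    · exact Measure.ae_le_iff_absolutelyContinuous.mp hae.ge
    · exact Measure.ae_le_iff_absolutelyContinuous.mp hae.le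
  constructor
  · intro h
    refine ⟨hm.mp h.1, ?_⟩
    have := (memLp_two_iff_integrable_sq_norm h.1).mp h
    rwa [integrable_withDensity_ofReal hρ hpos] at this
  · rintro ⟨h1, h2⟩
    rw [memLp_two_iff_integrable_sq_norm (hm.mpr h1), integrable_withDensity_ofReal hρ hpos]
    exact h2

section

variable {ν : ℝ} {f g : ℂ → ℂ}

theorem memLp_fockMeasure_iff :
    MemLp f 2 (fockMeasure ν) ↔
      AEStronglyMeasurable f ∧ Integrable fun z => Real.exp (-ν * ‖z‖ ^ 2) * ‖f z‖ ^ 2 :=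
  memLp_two_withDensity_iff (by fun_prop) fun _ => Real.exp_pos _

theorem integrable_mul_gaussW (hf : MemLp f 2 (fockMeasure ν)) (hg : MemLp g 2 (fockMeasure ν)) :
    Integrable fun z => g z * f z * gaussW ν z := by
  rw [memLp_fockMeasure_iff] at hf hg
  refine (hf.2.add hg.2).mono' ((hg.1.mul hf.1).mul
    ((contDiff_gaussW ν (n := 0)).continuous.aestronglyMeasurable)) (.of_forall fun z => ?_)
  rw [norm_mul, norm_mul, norm_gaussW, Pi.add_apply]
  have := mul_nonneg (Real.exp_pos (-ν * ‖z‖ ^ 2)).le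
    (add_nonneg (add_nonneg (sq_nonneg (‖f z‖ - ‖g z‖)) (sq_nonneg ‖f z‖)) (sq_nonneg ‖g z‖))
  nlinarith

theorem GaussBound.memLp {b : ℝ} (h : GaussBound b g) (hb : 2 * b < ν) (hc : Continuous g) :
    MemLp g 2 (fockMeasure ν) := by
  rw [memLp_fockMeasure_iff]
  refine ⟨hc.aestronglyMeasurable, ?_⟩
  have h1 := (((h.mul h).mul (gaussBound_gaussW ν)).integrable (by linarith)
    ((hc.mul hc).mul (contDiff_gaussW ν (n := 0)).continuous)).norm
  refine h1.congr (.of_forall fun z => ?_)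
  simp only [norm_mul, norm_gaussW]
  ring

theorem gaussBound_exp_mul_norm (R : ℝ) {δ : ℝ} (hδ : 0 < δ) :
    GaussBound δ fun z => (Real.exp (R * ‖z‖) : ℂ) := by
  refine ⟨Real.exp (R ^ 2 / (4 * δ)), fun z => ?_⟩
  rw [norm_real, Real.norm_of_nonneg (Real.exp_pos _).le, ← Real.exp_add, Real.exp_le_exp]
  have h : δ * ‖z‖ ^ 2 - R * ‖z‖ + R ^ 2 / (4 * δ) = δ * (‖z‖ - R / (2 * δ)) ^ 2 := by
    field_simp
    ring
  have := mul_nonneg hδ.le (sq_nonneg (‖z‖ - R / (2 * δ)))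
  linarith

theorem norm_cexp_mul_conj_le (hν : 0 < ν) (z ξ : ℂ) :
    ‖Complex.exp (ν * z * conj ξ)‖ ≤ Real.exp (ν * ‖z‖ * ‖ξ‖) := by
  rw [Complex.norm_exp, Real.exp_le_exp]
  refine (re_le_norm _).trans (le_of_eq ?_)
  simp [abs_of_pos hν]

/-! ### The Bargmann integrals -/

/-- The integral `∫ e^{ν z ξ̄} (z̄ - ξ̄)^n (-ξ̄)^k f(ξ) e^{-ν|ξ|²} dλ(ξ)`. The additional factor
`(-ξ̄)^k` makes the family stable under both Wirtinger derivatives. -/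
def bargmann (ν : ℝ) (f : ℂ → ℂ) (n k : ℕ) (z : ℂ) : ℂ :=
  ∫ ξ, Complex.exp (ν * z * conj ξ) * (conj z - conj ξ) ^ n * (-conj ξ) ^ k * f ξ * gaussW ν ξ

theorem memLp_bargmann_kernel (hν : 0 < ν) (n k : ℕ) (z : ℂ) :
    MemLp (fun ξ => Complex.exp (ν * z * conj ξ) * (conj z - conj ξ) ^ n * (-conj ξ) ^ k) 2
      (fockMeasure ν) := by
  have hδ : 0 < ν / 10 := by linarith
  have h1 : GaussBound (ν / 10) fun ξ => Complex.exp (ν * z * conj ξ) :=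
    (gaussBound_exp_mul_norm (ν * ‖z‖) hδ).of_norm_le fun ξ => by
      rw [norm_real, Real.norm_of_nonneg (Real.exp_pos _).le]
      exact norm_cexp_mul_conj_le hν z ξ
  have h2 (n : ℕ) : GaussBound (ν / 10) fun ξ => (conj z - conj ξ) ^ n := by
    -- `|z - ξ|^n ≤ n! e^{|z - ξ|} ≤ n! e^{|z|} e^{|ξ|}`
    refine ((gaussBound_exp_mul_norm 1 hδ).const_mul
      ((n.factorial * Real.exp ‖z‖ : ℝ) : ℂ)).of_norm_le fun ξ => ?_
    have h := Real.pow_div_factorial_le_exp ‖z - ξ‖ (norm_nonneg _) n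
    rw [div_le_iff₀ (by positivity)] at h
    have h' : Real.exp ‖z - ξ‖ ≤ Real.exp ‖z‖ * Real.exp ‖ξ‖ := by
      rw [← Real.exp_add, Real.exp_le_exp]
      exact norm_sub_le _ _
    rw [norm_pow, ← map_sub, RCLike.norm_conj, norm_mul, norm_real, norm_real,
      Real.norm_of_nonneg (by positivity), Real.norm_of_nonneg (by positivity), one_mul]
    calc ‖z - ξ‖ ^ n ≤ Real.exp ‖z - ξ‖ * n.factorial := h
      _ ≤ Real.exp ‖z‖ * Real.exp ‖ξ‖ * n.factorial := by gcongr
      _ = _ := by ring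
  have h3 : GaussBound (ν / 10) fun ξ => (-conj ξ) ^ k :=
    (gaussBound_pow k hδ).of_norm_le fun ξ => by simp
  refine ((h1.mul (h2 n)).mul h3).memLp (by linarith) ?_
  have := Complex.continuous_conj
  fun_prop

theorem integrable_bargmann (hν : 0 < ν) (hf : MemLp f 2 (fockMeasure ν)) (n k : ℕ) (z : ℂ) :
    Integrable fun ξ => Complex.exp (ν * z * conj ξ) * (conj z - conj ξ) ^ n * (-conj ξ) ^ k *
      f ξ * gaussW ν ξ :=
  integrable_mul_gaussW hf (memLp_bargmann_kernel hν n k z)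

theorem bargmann_succ (hν : 0 < ν) (hf : MemLp f 2 (fockMeasure ν)) (n k : ℕ) (z : ℂ) :
    bargmann ν f (n + 1) k z = conj z * bargmann ν f n k z + bargmann ν f n (k + 1) z := by
  rw [bargmann, bargmann, bargmann, ← integral_const_mul, ← integral_add
    ((integrable_bargmann hν hf n k z).const_mul _) (integrable_bargmann hν hf n (k + 1) z)]
  refine integral_congr_ae (.of_forall fun ξ => ?_)
  simp only []
  ring

theorem hasDerivAt_bargmann_zero (hν : 0 < ν) (hf : MemLp f 2 (fockMeasure ν)) (k : ℕ) (z : ℂ) :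
    HasDerivAt (bargmann ν f 0 k) (-ν * bargmann ν f 0 (k + 1) z) z := by
  have hb : Integrable fun ξ => ‖((ν : ℂ) * (Real.exp (ν * (‖z‖ + 1) * ‖ξ‖) : ℂ) * ξ ^ (k + 1)) *
      f ξ * gaussW ν ξ‖ := by
    refine (integrable_mul_gaussW hf ?_).norm
    have hδ : 0 < ν / 10 := by linarith
    refine (((gaussBound_exp_mul_norm (ν * (‖z‖ + 1)) hδ).const_mul ν).mul
      (gaussBound_pow (k + 1) hδ)).memLp (by linarith) ?_
    fun_prop
  have h := (hasDerivAt_integral_of_dominated_loc_of_deriv_le (μ := (volume : Measure ℂ))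
    (F := fun z ξ => Complex.exp (ν * z * conj ξ) * (conj z - conj ξ) ^ 0 * (-conj ξ) ^ k *
      f ξ * gaussW ν ξ)
    (F' := fun z ξ => -ν * (Complex.exp (ν * z * conj ξ) * (conj z - conj ξ) ^ 0 *
      (-conj ξ) ^ (k + 1) * f ξ * gaussW ν ξ))
    (x₀ := z) (Metric.ball_mem_nhds z one_pos)
    (.of_forall fun w => (integrable_bargmann hν hf 0 k w).aestronglyMeasurable)
    (integrable_bargmann hν hf 0 k z)
    ((integrable_bargmann hν hf 0 (k + 1) z).const_mul _).aestronglyMeasurable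
    (.of_forall fun ξ w hw => ?_) hb (.of_forall fun ξ w _ => ?_)).2
  · rwa [integral_const_mul] at h
  · have hw' : ‖w‖ ≤ ‖z‖ + 1 := by
      have := norm_le_norm_add_norm_sub z w
      rw [← dist_eq_norm] at this
      linarith [Metric.mem_ball'.mp hw]
    have h1 : ‖Complex.exp (ν * w * conj ξ)‖ ≤ Real.exp (ν * (‖z‖ + 1) * ‖ξ‖) := by
      refine (norm_cexp_mul_conj_le hν w ξ).trans (Real.exp_le_exp.mpr ?_)
      gcongr
    simp only [norm_mul, norm_neg, pow_zero, mul_one, norm_pow, RCLike.norm_conj,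
      norm_real, Real.norm_of_nonneg (Real.exp_pos _).le]
    rw [← mul_assoc, ← mul_assoc, ← mul_assoc]
    gcongr
  · have h1 : HasDerivAt (fun w : ℂ => Complex.exp (ν * w * conj ξ))
        (ν * conj ξ * Complex.exp (ν * w * conj ξ)) w := by
      refine (((hasDerivAt_id w).const_mul (ν : ℂ)).mul_const (conj ξ)).cexp.congr_deriv ?_
      simp
      ring
    simp only [pow_zero, mul_one]
    refine (((h1.mul_const ((-conj ξ) ^ k)).mul_const (f ξ)).mul_const (gaussW ν ξ)).congr_deriv ?_
    ring

theorem hasWirtinger_bargmann (hν : 0 < ν) (hf : MemLp f 2 (fockMeasure ν)) (n k : ℕ) (z : ℂ) :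
    HasWirtinger (bargmann ν f n k) (-ν * bargmann ν f n (k + 1) z)
      (n * bargmann ν f (n - 1) k z) z := by
  induction n generalizing k with
  | zero =>
    exact (HasDerivAt.hasWirtinger (hasDerivAt_bargmann_zero hν hf k z)).congr_deriv rfl (by simp)
  | succ n ih =>
    have e : bargmann ν f (n + 1) k =
        fun z => conj z * bargmann ν f n k z + bargmann ν f n (k + 1) z :=
      funext (bargmann_succ hν hf n k)
    rw [e]
    refine (((hasWirtinger_conj z).mul (ih k)).add (ih (k + 1))).congr_deriv ?_ ?_
    · rw [bargmann_succ hν hf n (k + 1)]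
      ring
    · cases n with
      | zero => simp
      | succ n =>
        rw [Nat.add_sub_cancel, Nat.add_sub_cancel, bargmann_succ hν hf n k]
        push_cast
        ring

theorem contDiff_bargmann (hν : 0 < ν) (hf : MemLp f 2 (fockMeasure ν)) (n k : ℕ)
    {m : WithTop ℕ∞} : ContDiff ℝ m (bargmann ν f n k) := by
  induction n generalizing k with
  | zero =>
    have : Differentiable ℂ (bargmann ν f 0 k) := fun z =>
      (hasDerivAt_bargmann_zero hν hf k z).differentiableAt
    exact this.contDiff.restrict_scalars ℝ
  | succ n ih =>
    have e : bargmann ν f (n + 1) k =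
        fun z => conj z * bargmann ν f n k z + bargmann ν f n (k + 1) z :=
      funext (bargmann_succ hν hf n k)
    rw [e]
    exact (conjCLE.contDiff.mul (ih k)).add (ih (k + 1))

theorem nabla_bargmann (hν : 0 < ν) (hf : MemLp f 2 (fockMeasure ν)) (n : ℕ) :
    nabla ν 0 (bargmann ν f n 0) = (ν : ℂ) • bargmann ν f (n + 1) 0 := by
  funext z
  simp only [nabla, (hasWirtinger_bargmann hν hf n 0 z).dz, Pi.smul_apply, smul_eq_mul,
    bargmann_succ hν hf n 0, ofReal_zero]
  ring

theorem magLaplacian_bargmann (hν : 0 < ν) (hf : MemLp f 2 (fockMeasure ν)) (n : ℕ) (z : ℂ) :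
    magLaplacian ν (bargmann ν f n 0) z = n * ν * bargmann ν f n 0 z := by
  have e : dzbar (bargmann ν f n 0) = (n : ℂ) • bargmann ν f (n - 1) 0 :=
    funext fun z => (hasWirtinger_bargmann hν hf n 0 z).dzbar
  rw [magLaplacian_eq_nabla, e, nabla_smul _
    ((contDiff_bargmann hν hf (n - 1) 0 (m := 1)).differentiable one_ne_zero),
    nabla_bargmann hν hf]
  cases n with
  | zero => simp
  | succ n =>
    simp only [Pi.smul_apply, smul_eq_mul, Nat.add_sub_cancel]
    ring

/-! ### The reproducing property -/

/-- Mean value property for the Gaussian measure, by averaging over rotations. -/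
theorem integral_mul_gaussW_of_differentiable (hν : 0 < ν) {h : ℂ → ℂ} (hd : Differentiable ℂ h)
    (hi : Integrable fun z => h z * gaussW ν z) : ∫ z, h z * gaussW ν z = Real.pi / ν * h 0 := by
  have hrot (θ : ℝ) : ∃ e : ℂ ≃ₗᵢ[ℝ] ℂ, ∀ z, e z = circleMap 0 1 θ * z :=
    ⟨rotation (Circle.exp θ), fun z => by simp [circleMap, rotation_apply]⟩
  have hW (θ : ℝ) (z : ℂ) : gaussW ν (circleMap 0 1 θ * z) = gaussW ν z := by
    rw [gaussW_eq, gaussW_eq, norm_mul, norm_circleMap_zero, abs_one, one_mul]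
  have hslice (θ : ℝ) : Integrable fun z => h (circleMap 0 1 θ * z) * gaussW ν z := by
    obtain ⟨e, he⟩ := hrot θ
    refine (e.measurePreserving.integrable_comp_emb
      e.toMeasurableEquiv.measurableEmbedding).mpr hi |>.congr (.of_forall fun z => ?_)
    simp only [Function.comp_apply, he, hW]
  have hrotint (θ : ℝ) : ∫ z, h (circleMap 0 1 θ * z) * gaussW ν z = ∫ z, h z * gaussW ν z := by
    obtain ⟨e, he⟩ := hrot θ
    rw [← e.measurePreserving.integral_comp e.toMeasurableEquiv.measurableEmbedding
      fun z => h z * gaussW ν z]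
    simp only [he, hW]
  have hrotnorm (θ : ℝ) :
      ∫ z, ‖h (circleMap 0 1 θ * z) * gaussW ν z‖ = ∫ z, ‖h z * gaussW ν z‖ := by
    obtain ⟨e, he⟩ := hrot θ
    rw [← e.measurePreserving.integral_comp e.toMeasurableEquiv.measurableEmbedding
      fun z => ‖h z * gaussW ν z‖]
    simp only [he, hW]
  have hcW := (contDiff_gaussW ν (n := 0)).continuous
  have hcc : Continuous (circleMap 0 1) := continuous_circleMap 0 1
  have hcirc (z : ℂ) : ∫ θ in Set.Ioc 0 (2 * Real.pi), h (circleMap 0 1 θ * z) =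
      2 * Real.pi * h 0 := by
    have hm := DiffContOnCl.circleAverage (f := fun w => h (w * z)) (c := 0) (R := 1)
      (Differentiable.diffContOnCl (hd.comp (differentiable_id.mul_const z)))
    rw [Real.circleAverage_def, intervalIntegral.integral_of_le Real.two_pi_pos.le] at hm
    rw [zero_mul] at hm
    rw [← hm, real_smul]
    have : (Real.pi : ℂ) ≠ 0 := by exact_mod_cast Real.pi_ne_zero
    push_cast
    rw [mul_inv_cancel_left₀ (by simp)]
  have hprod : Integrable (Function.uncurry fun (θ : ℝ) (z : ℂ) =>
      h (circleMap 0 1 θ * z) * gaussW ν z)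
      ((volume.restrict (Set.Ioc 0 (2 * Real.pi))).prod volume) := by
    rw [integrable_prod_iff]
    · refine ⟨.of_forall fun θ => hslice θ, ?_⟩
      simp only [Function.uncurry_apply_pair, hrotnorm]
      exact integrable_const _
    · have := hd.continuous
      refine Continuous.aestronglyMeasurable ?_
      unfold Function.uncurry
      fun_prop
  have hswap := integral_integral_swap hprod
  simp only [hrotint, integral_mul_const, hcirc, integral_const_mul] at hswap
  have hgauss : ∫ z, gaussW ν z = Real.pi / ν := by
    simp_rw [gaussW_eq]
    rw [integral_complex_ofReal, GaussianFourier.integral_rexp_neg_mul_sq_norm hν]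
    simp
  rw [hgauss] at hswap
  simp at hswap
  have h2 : (Real.pi : ℂ) ≠ 0 := by exact_mod_cast Real.pi_ne_zero
  rw [max_eq_left Real.two_pi_pos.le] at hswap
  push_cast at hswap
  refine mul_left_cancel₀ (mul_ne_zero two_ne_zero h2) ?_
  rw [hswap]
  ring

/-- The Bargmann integral reproduces the entire functions of the Fock space. -/
theorem bargmann_zero_of_differentiable (hν : 0 < ν) (hf : MemLp f 2 (fockMeasure ν))
    (hd : Differentiable ℂ f) (z : ℂ) : bargmann ν f 0 0 z = Real.pi / ν * f z := by
  have hi := integrable_bargmann hν hf 0 0 z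
  have e (w : ℂ) : Complex.exp (ν * z * conj (w + z)) * (conj z - conj (w + z)) ^ 0 *
      (-conj (w + z)) ^ 0 * f (w + z) * gaussW ν (w + z) =
      Complex.exp (-ν * w * conj z) * f (w + z) * gaussW ν w := by
    simp only [pow_zero, mul_one, gaussW, map_add]
    rw [mul_right_comm, ← Complex.exp_add, mul_right_comm _ (f (w + z)), ← Complex.exp_add]
    congr 2
    ring
  have hi' : Integrable fun w => Complex.exp (-ν * w * conj z) * f (w + z) * gaussW ν w :=
    (hi.comp_add_right z).congr (.of_forall e)
  rw [bargmann, ← integral_add_right_eq_self _ z]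
  simp_rw [e]
  rw [integral_mul_gaussW_of_differentiable hν _ hi']
  · simp
  · have : Differentiable ℂ fun w => f (w + z) := hd.comp (differentiable_id.add_const z)
    fun_prop

/-- On entire functions of the Fock space, the Bargmann integrals are the iterates of the creation
operator. -/
theorem bargmann_eq_iterate_nabla (hν : 0 < ν) (hf : MemLp f 2 (fockMeasure ν))
    (hd : Differentiable ℂ f) (n : ℕ) :
    bargmann ν f n 0 = (Real.pi / ν / ν ^ n : ℂ) • (nabla ν 0)^[n] f := by
  have hν' : (ν : ℂ) ≠ 0 := by exact_mod_cast hν.ne'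
  induction n with
  | zero =>
    funext z
    simp [bargmann_zero_of_differentiable hν hf hd z]
  | succ n ih =>
    have h1 : bargmann ν f (n + 1) 0 = (1 / ν : ℂ) • nabla ν 0 (bargmann ν f n 0) := by
      rw [nabla_bargmann hν hf n, smul_smul]
      simp [hν']
    have h2 : Differentiable ℝ ((nabla ν 0)^[n] f) := by
      have hc : ContDiff ℝ ∞ ((nabla ν 0)^[n] f) := by
        have hc0 : ContDiff ℝ ∞ f := hd.contDiff.restrict_scalars ℝ
        clear h1 ih
        induction n with
        | zero => exact hc0
        | succ n ih =>
          rw [Function.iterate_succ_apply']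
          exact contDiff_nabla 0 ih
      exact hc.differentiable (by simp)
    rw [h1, ih, nabla_smul _ h2, smul_smul, Function.iterate_succ_apply']
    congr 1
    field_simp
    ring

end

/-! ### The isometry between the two weighted spaces -/

theorem mulExp_apply (a : ℝ) (f : ℂ → ℂ) (z : ℂ) :
    mulExp a f z = Complex.exp (a * z ^ 2) * f z := rfl

theorem mulExp_mulExp_neg (a : ℝ) (f : ℂ → ℂ) : mulExp a (mulExp (-a) f) = f := by
  funext z
  rw [mulExp_apply, mulExp_apply, ← mul_assoc, ← Complex.exp_add]
  simp

theorem mulExp_neg_mulExp (a : ℝ) (f : ℂ → ℂ) : mulExp (-a) (mulExp a f) = f := by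
  simpa using mulExp_mulExp_neg (-a) f

theorem continuous_cexp_mul_sq (a : ℝ) : Continuous fun z : ℂ => Complex.exp (a * z ^ 2) := by
  fun_prop

theorem continuous_omega (s : ℝ) : Continuous (omega s) := by
  have := Complex.continuous_conj
  have := Complex.continuous_re
  unfold omega
  fun_prop

theorem omega_pos (s : ℝ) (z : ℂ) : 0 < omega s z := Real.exp_pos _

theorem ae_muS (s : ℝ) : ae (muS s) = ae volume :=
  ae_withDensity_ofReal (continuous_omega s) (omega_pos s)

theorem integral_muS (s : ℝ) (f : ℂ → ℂ) : ∫ z, f z ∂muS s = ∫ z, omega s z • f z :=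
  integral_withDensity_ofReal (continuous_omega s) (omega_pos s) f

theorem omega_eq (s : ℝ) (z : ℂ) :
    (omega s z : ℂ) = Complex.exp (alpha s * z ^ 2) * conj (Complex.exp (alpha s * z ^ 2)) *
      gaussW (nu s) z := by
  have h : (((z ^ 2 + conj z ^ 2).re : ℝ) : ℂ) = z ^ 2 + conj z ^ 2 := by
    rw [← conj_eq_iff_re]
    simp [add_comm]
  rw [omega, ofReal_exp, ← exp_conj, ← Complex.exp_add, gaussW, ← Complex.exp_add, mul_conj,
    normSq_eq_norm_sq]
  congr 1
  push_cast
  rw [h]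
  simp only [map_mul, map_pow, conj_ofReal]
  ring

theorem omega_eq_norm (s : ℝ) (z : ℂ) :
    omega s z = ‖Complex.exp (alpha s * z ^ 2)‖ ^ 2 * Real.exp (-nu s * ‖z‖ ^ 2) := by
  have h := omega_eq s z
  rw [mul_conj, normSq_eq_norm_sq, gaussW_eq] at h
  exact_mod_cast h

section

variable {s : ℝ} {f g : ℂ → ℂ}

theorem memLp_muS_iff :
    MemLp f 2 (muS s) ↔ AEStronglyMeasurable f ∧ Integrable fun z => omega s z * ‖f z‖ ^ 2 :=
  memLp_two_withDensity_iff (continuous_omega s) (omega_pos s)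

theorem memLp_mulExp (hf : MemLp f 2 (muS s)) :
    MemLp (mulExp (alpha s) f) 2 (fockMeasure (nu s)) := by
  rw [memLp_muS_iff] at hf
  rw [memLp_fockMeasure_iff]
  refine ⟨(continuous_cexp_mul_sq _).aestronglyMeasurable.mul hf.1,
    hf.2.congr (.of_forall fun z => ?_)⟩
  simp only [mulExp_apply, omega_eq_norm, norm_mul]
  ring

theorem memLp_mulExp_neg (hg : MemLp g 2 (fockMeasure (nu s))) :
    MemLp (mulExp (-alpha s) g) 2 (muS s) := by
  rw [memLp_fockMeasure_iff] at hg
  rw [memLp_muS_iff]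
  refine ⟨(continuous_cexp_mul_sq _).aestronglyMeasurable.mul hg.1,
    hg.2.congr (.of_forall fun z => ?_)⟩
  beta_reduce
  conv_lhs => rw [← mulExp_mulExp_neg (alpha s) g]
  rw [mulExp_apply, omega_eq_norm, norm_mul]
  ring

/-- The inner product of `ℋ^{2,s}(ℂ)` is transported to the Gaussian pairing by `M_α`. -/
theorem inner_toLp_mulExp_neg (hg : MemLp g 2 (fockMeasure (nu s))) (F : Lp ℂ 2 (muS s)) :
    inner ℂ ((memLp_mulExp_neg hg).toLp _) F = gaussPair (nu s) g (mulExp (alpha s) F) := by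
  rw [L2.inner_def]
  have h1 : ∫ z, inner ℂ ((memLp_mulExp_neg hg).toLp _ z) (F z) ∂muS s =
      ∫ z, F z * conj (mulExp (-alpha s) g z) ∂muS s := by
    refine integral_congr_ae ?_
    filter_upwards [(memLp_mulExp_neg hg).coeFn_toLp] with z hz
    rw [hz, RCLike.inner_apply]
  rw [h1, integral_muS, gaussPair]
  refine integral_congr_ae (.of_forall fun z => ?_)
  have h2 : conj (g z) = conj (Complex.exp (alpha s * z ^ 2)) * conj (mulExp (-alpha s) g z) := by
    rw [← map_mul, ← mulExp_apply, mulExp_mulExp_neg]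
  simp only [real_smul, omega_eq, h2, mulExp_apply]
  ring

end

/-! ### The parameters -/

section

variable {s : ℝ}

theorem nu_pos (hs0 : 0 < s) (hs1 : s < 1) : 0 < nu s := by
  have : 0 < 1 - s ^ 2 := by nlinarith
  unfold nu
  positivity

theorem alpha_sub_half (hs0 : 0 < s) : alpha s - 1 / 2 = (1 - s) ^ 2 / (4 * s) := by
  unfold alpha
  field_simp
  ring

theorem alpha_sub_half_nonneg (hs0 : 0 < s) : 0 ≤ alpha s - 1 / 2 := by
  rw [alpha_sub_half hs0]
  positivity

theorem nu_sub_alpha (hs0 : 0 < s) : nu s - 2 * (alpha s - 1 / 2) = 1 - s := by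
  unfold nu alpha
  field_simp
  ring

theorem nu_add_alpha (hs0 : 0 < s) : nu s + 2 * (alpha s - 1 / 2) = (1 - s) / s := by
  unfold nu alpha
  field_simp
  ring

theorem two_alpha_sub_half_lt (hs0 : 0 < s) (hs1 : s < 1) : 2 * (alpha s - 1 / 2) < nu s := by
  have := nu_sub_alpha hs0
  linarith

theorem alpha_mul_eq_nu_sq (hs0 : 0 < s) :
    2 * (alpha s - 1 / 2) * (2 + 2 * (alpha s - 1 / 2)) = nu s ^ 2 := by
  unfold nu alpha
  field_simp
  ring

theorem alpha_div_nu (hs0 : 0 < s) (hs1 : s < 1) :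
    (2 + 2 * (alpha s - 1 / 2)) / nu s = (1 + s) / (1 - s) := by
  have h1 : 1 - s ≠ 0 := by linarith
  rw [div_eq_div_iff (nu_pos hs0 hs1).ne' h1]
  unfold nu alpha
  field_simp
  ring

/-- The normalizing constant of `ψ_{m,n}^s`. -/
def psiConst (s : ℝ) (m n : ℕ) : ℝ :=
  Real.sqrt ((1 - s) / (Real.pi * nu s ^ n * n.factorial * Real.sqrt s)) *
    ((1 - s) / (1 + s)) ^ ((m : ℝ) / 2) / Real.sqrt (2 ^ m * m.factorial)

theorem psiConst_sq (hs0 : 0 < s) (hs1 : s < 1) (m n : ℕ) :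
    psiConst s m n ^ 2 = (1 - s) / (Real.pi * nu s ^ n * n.factorial * Real.sqrt s) *
      ((1 - s) / (1 + s)) ^ m / (2 ^ m * m.factorial) := by
  have hν := nu_pos hs0 hs1
  have h1 : 0 < 1 - s := by linarith
  have h2 : (((1 - s) / (1 + s)) ^ ((m : ℝ) / 2)) ^ 2 = ((1 - s) / (1 + s)) ^ m := by
    rw [← Real.rpow_natCast (_ ^ _) 2, ← Real.rpow_mul (by positivity), ← Real.rpow_natCast]
    congr 1
    push_cast
    ring
  rw [psiConst, div_pow, mul_pow, h2, Real.sq_sqrt (by positivity), Real.sq_sqrt (by positivity)]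

theorem psiConst_pos (hs0 : 0 < s) (hs1 : s < 1) (m n : ℕ) : 0 < psiConst s m n := by
  have hν := nu_pos hs0 hs1
  have h1 : 0 < 1 - s := by linarith
  unfold psiConst
  positivity

/-- Multiplication by `e^{α z²}` turns `ψ_{m,n}^s` into a multiple of the `n`-th creation operator
applied to `e^{(α - 1/2) z²} H_m`. -/
theorem psi_eq (m n : ℕ) :
    psi s m n = mulExp (-alpha s)
      ((psiConst s m n : ℂ) • creation (nu s) (alpha s - 1 / 2) n m) := by
  funext z
  have h := congrFun (iterate_nabla_mulExp (ν := nu s) (alpha s - 1 / 2) n (contDiff_hermiteH m)) z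
  rw [creation, gaussHermite, mulExp_apply, Pi.smul_apply, h, mulExp_apply, psi, ← psiConst,
    smul_eq_mul]
  have e : Complex.exp (-z ^ 2 / 2) = Complex.exp (((-alpha s : ℝ) : ℂ) * z ^ 2) *
      Complex.exp (((alpha s - 1 / 2 : ℝ) : ℂ) * z ^ 2) := by
    rw [← Complex.exp_add]
    congr 1
    push_cast
    ring
  rw [e]
  ring

theorem memLp_of_mem_gaussPoly (hs0 : 0 < s) (hs1 : s < 1) {f : ℂ → ℂ}
    (hf : f ∈ gaussPoly (alpha s - 1 / 2)) : MemLp f 2 (fockMeasure (nu s)) := by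
  obtain ⟨b, hab, hbν⟩ := exists_between
    (show alpha s - 1 / 2 < nu s / 2 by linarith [two_alpha_sub_half_lt hs0 hs1])
  exact (gaussBound_of_mem_gaussPoly (alpha_sub_half_nonneg hs0) hab hf).memLp (by linarith)
    (contDiff_of_mem_gaussPoly (n := 0) hf).continuous

theorem memLp_psi_fock (hs0 : 0 < s) (hs1 : s < 1) (n m : ℕ) :
    MemLp ((psiConst s m n : ℂ) • creation (nu s) (alpha s - 1 / 2) n m) 2 (fockMeasure (nu s)) :=
  memLp_of_mem_gaussPoly hs0 hs1 (Submodule.smul_mem _ _ (creation_mem n m))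

theorem psi_mem_polySpace (hs0 : 0 < s) (hs1 : s < 1) (m n : ℕ) :
    psi s m n ∈ polySpace s n := by
  refine ⟨_, ?_, (psi_eq m n).symm⟩
  refine Submodule.smul_mem _ _ ⟨contDiff_of_mem_gaussPoly (creation_mem n m),
    memLp_of_mem_gaussPoly hs0 hs1 (creation_mem n m), magLaplacian_creation n m⟩

/-! ### The orthonormal basis `ψ_{m,n}` of the whole space -/

/-- The class of `ψ_{m,n}^s` in `ℋ^{2,s}(ℂ)`, with the index `n` of the eigenspace first. -/
def psiLp (hs0 : 0 < s) (hs1 : s < 1) (n m : ℕ) : Lp ℂ 2 (muS s) :=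
  (memLp_mulExp_neg (memLp_psi_fock hs0 hs1 n m)).toLp _

theorem coeFn_psiLp (hs0 : 0 < s) (hs1 : s < 1) (n m : ℕ) :
    psiLp hs0 hs1 n m =ᵐ[muS s] psi s m n := by
  rw [psi_eq]
  exact MemLp.coeFn_toLp _

theorem gaussPair_congr {ν : ℝ} {u v w : ℂ → ℂ} (h : v =ᵐ[volume] w) :
    gaussPair ν u v = gaussPair ν u w := by
  refine integral_congr_ae ?_
  filter_upwards [h] with z hz
  rw [hz]

theorem mulExp_congr_ae {a : ℝ} {f g : ℂ → ℂ} (h : f =ᵐ[muS s] g) :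
    mulExp a f =ᵐ[volume] mulExp a g := by
  have h' : f =ᵐ[volume] g := by
    rwa [Filter.EventuallyEq, ae_muS] at h
  filter_upwards [h'] with z hz
  rw [mulExp_apply, mulExp_apply, hz]

theorem inner_psiLp (hs0 : 0 < s) (hs1 : s < 1) (n m : ℕ) (F : Lp ℂ 2 (muS s)) :
    inner ℂ (psiLp hs0 hs1 n m) F = psiConst s m n *
      gaussPair (nu s) (creation (nu s) (alpha s - 1 / 2) n m) (mulExp (alpha s) F) := by
  rw [psiLp, inner_toLp_mulExp_neg (memLp_psi_fock hs0 hs1 n m), gaussPair_smul_left, conj_ofReal]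

theorem inner_psiLp_psiLp (hs0 : 0 < s) (hs1 : s < 1) (n m k l : ℕ) :
    inner ℂ (psiLp hs0 hs1 n m) (psiLp hs0 hs1 k l) = if n = k ∧ m = l then 1 else 0 := by
  have ha := alpha_sub_half_nonneg hs0
  have haν := two_alpha_sub_half_lt hs0 hs1
  have h : mulExp (alpha s) (psiLp hs0 hs1 k l) =ᵐ[volume]
      (psiConst s l k : ℂ) • creation (nu s) (alpha s - 1 / 2) k l := by
    refine (mulExp_congr_ae (coeFn_psiLp hs0 hs1 k l)).trans ?_
    rw [psi_eq, mulExp_mulExp_neg]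
  rw [inner_psiLp, gaussPair_congr h, gaussPair_smul_right, gaussPair_creation ha haν]
  by_cases hnk : n = k
  · subst hnk
    rw [if_pos rfl, gaussPair_gaussHermite ha haν (alpha_mul_eq_nu_sq hs0)]
    by_cases hml : m = l
    · subst hml
      rw [if_pos rfl, if_pos ⟨rfl, rfl⟩, gaussPair_gaussHermite_zero, nu_sub_alpha hs0,
        nu_add_alpha hs0]
      have hc := alpha_div_nu hs0 hs1
      have hν := nu_pos hs0 hs1
      have h1 : 0 < 1 - s := by linarith
      have hsq : √(Real.pi / (1 - s)) * √(Real.pi / ((1 - s) / s)) = Real.pi * √s / (1 - s) := by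
        rw [← Real.sqrt_mul (by positivity), show Real.pi / (1 - s) * (Real.pi / ((1 - s) / s)) =
          (Real.pi / (1 - s)) ^ 2 * s by field_simp, Real.sqrt_mul (by positivity),
          Real.sqrt_sq (by positivity)]
        ring
      have key : psiConst s m n * (psiConst s m n * (nu s ^ n * n.factorial *
          (((2 + 2 * (alpha s - 1 / 2)) / nu s * 2) ^ m * m.factorial *
            (√(Real.pi / (1 - s)) * √(Real.pi / ((1 - s) / s)))))) = 1 := by
        have hss : √s ≠ 0 := (Real.sqrt_pos.mpr hs0).ne'
        rw [hc, hsq, ← mul_assoc, ← pow_two, psiConst_sq hs0 hs1, div_pow, mul_pow, div_pow]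
        field_simp
      exact_mod_cast key
    · rw [if_neg hml, if_neg fun h => hml h.2]
      simp
  · rw [if_neg hnk, if_neg fun h => hnk h.1]
    simp

theorem orthonormal_psiLp (hs0 : 0 < s) (hs1 : s < 1) :
    Orthonormal ℂ fun p : ℕ × ℕ => psiLp hs0 hs1 p.1 p.2 := by
  rw [orthonormal_iff_ite]
  rintro ⟨n, m⟩ ⟨k, l⟩
  simp only [inner_psiLp_psiLp, Prod.mk.injEq]

theorem integrable_gaussPair_of_memLp {ν : ℝ} {u v : ℂ → ℂ} (hu : MemLp u 2 (fockMeasure ν))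
    (hv : MemLp v 2 (fockMeasure ν)) : Integrable fun z => conj (u z) * v z * gaussW ν z := by
  refine integrable_mul_gaussW hv ?_
  rw [memLp_fockMeasure_iff] at hu ⊢
  exact ⟨Complex.continuous_conj.comp_aestronglyMeasurable hu.1, by simpa using hu.2⟩

/-- The family `ψ_{m,n}` is complete: a function orthogonal to it is, after multiplication by
`e^{α z²}`, orthogonal to all `e^{a z²} z^j z̄^k`, and is determined by these moments. -/
theorem eq_zero_of_inner_psiLp (hs0 : 0 < s) (hs1 : s < 1) {F : Lp ℂ 2 (muS s)}
    (h : ∀ n m, inner ℂ (psiLp hs0 hs1 n m) F = 0) : F = 0 := by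
  set a := alpha s - 1 / 2 with ha_def
  set g := mulExp (alpha s) F with hg_def
  have hg : MemLp g 2 (fockMeasure (nu s)) := memLp_mulExp (Lp.memLp F)
  have hν := nu_pos hs0 hs1
  have h0 (n m : ℕ) : gaussPair (nu s) (creation (nu s) a n m) g = 0 := by
    have := h n m
    rw [inner_psiLp] at this
    refine (mul_eq_zero.mp this).resolve_left ?_
    exact_mod_cast (psiConst_pos hs0 hs1 m n).ne'
  have hi {u : ℂ → ℂ} (hu : u ∈ gaussPoly a) :=
    integrable_gaussPair_of_memLp (memLp_of_mem_gaussPoly hs0 hs1 hu) hg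
  have h1 : ∀ u ∈ gaussPoly a, gaussPair (nu s) u g = 0 := by
    intro u hu
    have hu' := gaussPoly_le_span_creation hν.ne' hu
    have hle : Submodule.span ℂ (Set.range fun p : ℕ × ℕ => creation (nu s) a p.1 p.2) ≤
        gaussPoly a := by
      rw [Submodule.span_le]
      rintro _ ⟨p, rfl⟩
      exact creation_mem p.1 p.2
    induction hu' using Submodule.span_induction with
    | mem x hx => obtain ⟨p, rfl⟩ := hx; exact h0 p.1 p.2
    | zero => simp [gaussPair]
    | add x y hx hy h1 h2 =>
      have e : gaussPair (nu s) (x + y) g = gaussPair (nu s) x g + gaussPair (nu s) y g := by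
        rw [gaussPair, gaussPair, gaussPair, ← integral_add (hi (hle hx)) (hi (hle hy))]
        refine integral_congr_ae (.of_forall fun z => ?_)
        simp only [Pi.add_apply, map_add]
        ring
      rw [e, h1 (hle hx), h2 (hle hy), add_zero]
    | smul c x hx h => rw [gaussPair_smul_left, h (hle hx), mul_zero]
  have hmem : gaussMonomial a 0 0 ∈ gaussPoly a := gaussMonomial_mem a 0 0
  have haν := two_alpha_sub_half_lt hs0 hs1
  obtain ⟨b, hab, hbν⟩ := exists_between (show a < nu s / 2 by linarith)
  have h2 := ae_eq_zero_of_moments_eq_zero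
    (G := fun z => conj (Complex.exp (a * z ^ 2)) * g z * gaussW (nu s) z) ?_ ?_ ?_
  · rw [Lp.eq_zero_iff_ae_eq_zero, Filter.EventuallyEq, ae_muS]
    filter_upwards [h2] with z hz
    simpa [gaussW, hg_def, mulExp_apply] using hz
  · simpa [gaussMonomial] using (hi hmem).aestronglyMeasurable
  · intro c
    have hb : GaussBound (b / 2 + nu s / 4) fun z =>
        (Real.exp (c * ‖z‖) : ℂ) * conj (gaussMonomial a 0 0 z) :=
      ((gaussBound_exp_mul_norm c (δ := nu s / 4 - b / 2) (by linarith)).mul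
        (gaussBound_of_mem_gaussPoly (alpha_sub_half_nonneg hs0) hab hmem).star).mono
          (by linarith)
    have hc1 := Complex.continuous_conj
    have hc2 := (contDiff_gaussMonomial a 0 0 (n := 0)).continuous
    refine (integrable_mul_gaussW hg (hb.memLp (by linarith) (by fun_prop))).norm.congr
      (.of_forall fun z => ?_)
    simp only [norm_mul, norm_real, Real.norm_of_nonneg (Real.exp_pos _).le, gaussMonomial,
      pow_zero, mul_one]
    ring
  · intro j k
    rw [← h1 _ (gaussMonomial_mem a k j), gaussPair]
    refine integral_congr_ae (.of_forall fun z => ?_)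
    simp only [gaussMonomial, map_mul, map_pow, conj_conj]
    ring

theorem exists_hilbertBasis_psiLp (hs0 : 0 < s) (hs1 : s < 1) :
    ∃ B : HilbertBasis (ℕ × ℕ) ℂ (Lp ℂ 2 (muS s)), ∀ p, B p = psiLp hs0 hs1 p.1 p.2 := by
  refine ⟨HilbertBasis.mkOfOrthogonalEqBot (orthonormal_psiLp hs0 hs1) ?_, fun p => by
    rw [HilbertBasis.coe_mkOfOrthogonalEqBot]⟩
  rw [Submodule.eq_bot_iff]
  intro F hF
  refine eq_zero_of_inner_psiLp hs0 hs1 fun n m => ?_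
  exact (Submodule.mem_orthogonal _ _).mp hF _ (Submodule.subset_span ⟨(n, m), rfl⟩)

/-- A vector orthogonal to all `ψ_{m,k}` with `k ≠ n` is the sum of its expansion in the
`ψ_{m,n}`. -/
theorem hasSum_psiLp (hs0 : 0 < s) (hs1 : s < 1) {n : ℕ} {F : Lp ℂ 2 (muS s)}
    (h : ∀ k m, k ≠ n → inner ℂ (psiLp hs0 hs1 k m) F = 0) :
    HasSum (fun m => inner ℂ (psiLp hs0 hs1 n m) F • psiLp hs0 hs1 n m) F := by
  obtain ⟨B, hB⟩ := exists_hilbertBasis_psiLp hs0 hs1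
  have h1 := B.hasSum_repr F
  simp only [B.repr_apply_apply, hB] at h1
  have hinj : Function.Injective fun m : ℕ => (n, m) := fun m l hml => (Prod.mk.inj hml).2
  refine (hinj.hasSum_iff fun p hp => ?_).mpr h1
  have : p.1 ≠ n := fun hpn => hp ⟨p.2, by rw [← hpn]⟩
  rw [h p.1 p.2 this, zero_smul]

end

/-! ### The transforms `𝒲_n^s` -/

section

variable {s : ℝ} {f g : ℂ → ℂ}

/-- The constant in front of `𝒲_n^s`. -/
def transformConst (s : ℝ) (n : ℕ) : ℝ := nu s / Real.pi * Real.sqrt (nu s ^ n / n.factorial)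

theorem transformIntegrand_eq (n : ℕ) (f : ℂ → ℂ) (z ξ : ℂ) :
    transformIntegrand s n f z ξ = Complex.exp (nu s * z * conj ξ) * (conj z - conj ξ) ^ n *
      (-conj ξ) ^ 0 * mulExp (alpha s) f ξ * gaussW (nu s) ξ := by
  have e : Complex.exp (-nu s * (‖ξ‖ ^ 2 : ℝ) + alpha s * ξ ^ 2 + nu s * conj ξ * z) =
      Complex.exp (nu s * z * conj ξ) * Complex.exp (alpha s * ξ ^ 2) * gaussW (nu s) ξ := by
    rw [gaussW, mul_conj, normSq_eq_norm_sq, ← Complex.exp_add, ← Complex.exp_add]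
    congr 1
    ring
  rw [transformIntegrand, e, mulExp_apply]
  ring

theorem transformW_eq (n : ℕ) (f : ℂ → ℂ) :
    transformW s n f = mulExp (-alpha s)
      ((transformConst s n : ℂ) • bargmann (nu s) (mulExp (alpha s) f) n 0) := by
  funext z
  rw [transformW, mulExp_apply, Pi.smul_apply, bargmann, smul_eq_mul, ← transformConst]
  simp_rw [transformIntegrand_eq]
  rw [ofReal_neg]
  ring

theorem integrable_transformIntegrand (hs0 : 0 < s) (hs1 : s < 1) (n : ℕ)
    (hf : MemLp f 2 (muS s)) (z : ℂ) : Integrable (transformIntegrand s n f z) :=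
  (integrable_bargmann (nu_pos hs0 hs1) (memLp_mulExp hf) n 0 z).congr
    (.of_forall fun ξ => (transformIntegrand_eq n f z ξ).symm)

theorem transformW_congr_ae (n : ℕ) (h : f =ᵐ[muS s] g) : transformW s n f = transformW s n g := by
  rw [transformW_eq, transformW_eq]
  congr 2
  funext z
  refine integral_congr_ae ?_
  filter_upwards [mulExp_congr_ae (a := alpha s) h] with ξ hξ
  rw [hξ]

theorem bargmann_smul (ν : ℝ) (c : ℂ) (f : ℂ → ℂ) (n k : ℕ) :
    bargmann ν (c • f) n k = c • bargmann ν f n k := by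
  funext z
  rw [bargmann, Pi.smul_apply, bargmann, smul_eq_mul, ← integral_const_mul]
  refine integral_congr_ae (.of_forall fun ξ => ?_)
  simp only [Pi.smul_apply, smul_eq_mul]
  ring

theorem transformConst_mul_psiConst (hs0 : 0 < s) (hs1 : s < 1) (m n : ℕ) :
    transformConst s n * (psiConst s m 0 * (Real.pi / nu s / nu s ^ n)) = psiConst s m n := by
  have hν := nu_pos hs0 hs1
  have h1 : 0 < 1 - s := by linarith
  have e : √(nu s ^ n / n.factorial) / nu s ^ n * √((1 - s) / (Real.pi * √s)) =
      √((1 - s) / (Real.pi * nu s ^ n * n.factorial * √s)) := by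
    rw [← Real.sqrt_sq (show 0 ≤ nu s ^ n by positivity), ← Real.sqrt_div (by positivity),
      ← Real.sqrt_mul (by positivity), Real.sqrt_sq (show 0 ≤ nu s ^ n by positivity)]
    congr 1
    field_simp
  rw [psiConst, psiConst, transformConst, ← e]
  simp only [pow_zero, mul_one, Nat.factorial_zero, Nat.cast_one]
  field_simp

/-- `𝒲_n^s` sends `ψ_{m,0}` to `ψ_{m,n}`. -/
theorem transformW_psi (hs0 : 0 < s) (hs1 : s < 1) (m n : ℕ) :
    transformW s n (psi s m 0) = psi s m n := by
  have hd : Differentiable ℂ (gaussHermite (alpha s - 1 / 2) m) := fun z =>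
    (hasDerivAt_gaussHermite _ m z).differentiableAt
  rw [transformW_eq, psi_eq, psi_eq, mulExp_mulExp_neg, creation_zero, bargmann_smul,
    bargmann_eq_iterate_nabla (nu_pos hs0 hs1)
      (memLp_of_mem_gaussPoly hs0 hs1 (gaussHermite_mem _ m)) hd, smul_smul, smul_smul,
    ← transformConst_mul_psiConst hs0 hs1 m n, creation]
  push_cast
  rw [mul_assoc (transformConst s n : ℂ)]

theorem transformW_mem_polySpace (hs0 : 0 < s) (hs1 : s < 1) (n : ℕ) (hf : MemLp f 2 (muS s))
    (hW : MemLp (transformW s n f) 2 (muS s)) : transformW s n f ∈ polySpace s n := by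
  have hν := nu_pos hs0 hs1
  have hf' := memLp_mulExp hf
  refine ⟨_, ⟨?_, ?_, ?_⟩, (transformW_eq n f).symm⟩
  · exact contDiff_const.smul (contDiff_bargmann hν hf' n 0)
  · have h := memLp_mulExp hW
    rwa [transformW_eq, mulExp_mulExp_neg] at h
  · intro z
    have hd : ContDiff ℝ 2 (bargmann (nu s) (mulExp (alpha s) f) n 0) :=
      contDiff_bargmann hν hf' n 0
    have h := magLaplacian_bargmann hν hf' n z
    simp only [magLaplacian] at h ⊢
    rw [dzbar_smul _ (hd.differentiable two_ne_zero), dz_smul _ (differentiable_dzbar hd)]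
    simp only [Pi.smul_apply, smul_eq_mul]
    linear_combination (transformConst s n : ℂ) * h

theorem transformW_mem_holSpace (hs0 : 0 < s) (hs1 : s < 1) (hf : MemLp f 2 (muS s))
    (hW : MemLp (transformW s 0 f) 2 (muS s)) : transformW s 0 f ∈ holSpace s := by
  refine ⟨?_, hW⟩
  rw [transformW_eq]
  intro z
  have h1 := (hasDerivAt_bargmann_zero (nu_pos hs0 hs1) (memLp_mulExp hf) 0 z).differentiableAt
  have h2 := (hasDerivAt_cexp_mul_sq (-alpha s : ℝ) z).differentiableAt
  exact h2.mul (h1.const_smul _)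

/-- The values of `𝒲_n^s` are continuous linear functionals on `ℋ^{2,s}(ℂ)`. -/
theorem exists_inner_eq_transformW (hs0 : 0 < s) (hs1 : s < 1) (n : ℕ) (z : ℂ) :
    ∃ K : Lp ℂ 2 (muS s), ∀ F : Lp ℂ 2 (muS s), transformW s n F z = inner ℂ K F := by
  have hk := memLp_bargmann_kernel (nu_pos hs0 hs1) n 0 z
  have hk' : MemLp (fun ξ => conj (Complex.exp (((-alpha s : ℝ) : ℂ) * z ^ 2) * transformConst s n *
      (Complex.exp (nu s * z * conj ξ) * (conj z - conj ξ) ^ n * (-conj ξ) ^ 0))) 2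
      (fockMeasure (nu s)) := by
    have := hk.const_mul (Complex.exp (((-alpha s : ℝ) : ℂ) * z ^ 2) * transformConst s n)
    rw [memLp_fockMeasure_iff] at this ⊢
    exact ⟨Complex.continuous_conj.comp_aestronglyMeasurable this.1, by
      simpa only [RCLike.norm_conj] using this.2⟩
  refine ⟨(memLp_mulExp_neg hk').toLp _, fun F => ?_⟩
  rw [inner_toLp_mulExp_neg hk', transformW_eq, mulExp_apply, Pi.smul_apply, smul_eq_mul, bargmann,
    gaussPair, ← mul_assoc, ← integral_const_mul]
  refine integral_congr_ae (.of_forall fun ξ => ?_)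
  simp only [conj_conj]
  ring

/-- `𝒲_n^s` sends `∑ c_m ψ_{m,0}` to `∑ c_m ψ_{m,n}`: its values converge pointwise along the partial
sums, and a subsequence of the partial sums of the second series converges almost everywhere. -/
theorem transformW_ae_eq_of_hasSum (hs0 : 0 < s) (hs1 : s < 1) (n : ℕ) {c : ℕ → ℂ}
    {F G : Lp ℂ 2 (muS s)} (hF : HasSum (fun m => c m • psiLp hs0 hs1 0 m) F)
    (hG : HasSum (fun m => c m • psiLp hs0 hs1 n m) G) :
    (G : ℂ → ℂ) =ᵐ[muS s] transformW s n F := by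
  have hpt (z : ℂ) : Filter.Tendsto (fun N => ∑ m ∈ Finset.range N, c m * psi s m n z)
      Filter.atTop (nhds (transformW s n F z)) := by
    obtain ⟨K, hK⟩ := exists_inner_eq_transformW hs0 hs1 n z
    rw [hK]
    have h1 := (hF.mapL (innerSL ℂ K)).tendsto_sum_nat
    refine h1.congr fun N => Finset.sum_congr rfl fun m _ => ?_
    rw [map_smul, innerSL_apply_apply, ← hK, smul_eq_mul,
      transformW_congr_ae n (coeFn_psiLp hs0 hs1 0 m), transformW_psi hs0 hs1]
  obtain ⟨N, hN, hae⟩ := (tendstoInMeasure_of_tendsto_Lp hG.tendsto_sum_nat).exists_seq_tendsto_ae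
  have hsum (k : ℕ) : (∑ m ∈ Finset.range k, c m • psiLp hs0 hs1 n m : Lp ℂ 2 (muS s))
      =ᵐ[muS s] fun z => ∑ m ∈ Finset.range k, c m * psi s m n z := by
    induction k with
    | zero =>
      simp only [Finset.range_zero, Finset.sum_empty]
      exact Lp.coeFn_zero _ _ _
    | succ k ih =>
      rw [Finset.sum_range_succ]
      filter_upwards [Lp.coeFn_add (∑ m ∈ Finset.range k, c m • psiLp hs0 hs1 n m)
        (c k • psiLp hs0 hs1 n k), ih, Lp.coeFn_smul (c k) (psiLp hs0 hs1 n k),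
        coeFn_psiLp hs0 hs1 n k] with z h1 h2 h3 h4
      rw [h1, Pi.add_apply, h2, h3, Pi.smul_apply, h4, Finset.sum_range_succ, smul_eq_mul]
  filter_upwards [hae, ae_all_iff.mpr hsum] with z h1 h2
  simp only [h2] at h1
  exact tendsto_nhds_unique h1 ((hpt z).comp hN.tendsto_atTop)

/-! ### Expansions in the spaces `𝒳_{n,s}` -/

theorem summable_psiLp_iff (hs0 : 0 < s) (hs1 : s < 1) (n : ℕ) (c : ℕ → ℂ) :
    Summable (fun m => c m • psiLp hs0 hs1 n m) ↔ Summable fun m => ‖c m‖ ^ 2 := by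
  have ho : Orthonormal ℂ fun m => psiLp hs0 hs1 n m :=
    (orthonormal_psiLp hs0 hs1).comp (fun m : ℕ => (n, m)) fun _ _ h => (Prod.mk.inj h).2
  rw [← ho.orthogonalFamily.summable_iff_norm_sq_summable]
  rfl

/-- `𝒳_{n,s}` is orthogonal to the `ψ_{m,k}` with `k ≠ n`, which are eigenfunctions of the magnetic
Laplacian (after multiplication by `e^{α z²}`) for another eigenvalue. -/
theorem inner_psiLp_of_mem_XPoly (hs0 : 0 < s) (hs1 : s < 1) {n k : ℕ} (hkn : k ≠ n) (m : ℕ)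
    {F : Lp ℂ 2 (muS s)} (hF : F ∈ XPoly s n) : inner ℂ (psiLp hs0 hs1 k m) F = 0 := by
  obtain ⟨f, ⟨g, ⟨hg, hgL, hgΔ⟩, rfl⟩, hFg⟩ := hF
  have hν := nu_pos hs0 hs1
  have h1 : mulExp (alpha s) F =ᵐ[volume] g := by
    refine (mulExp_congr_ae hFg).trans ?_
    rw [mulExp_mulExp_neg]
  have h2 := gaussPair_eq_zero_of_magLaplacian (ν := nu s) (a := alpha s - 1 / 2)
    (μ := n * nu s) (κ := k * nu s) hg
    (fun h hh => integrable_gaussPair_of_memLp (memLp_of_mem_gaussPoly hs0 hs1 hh) hgL)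
    (fun z => by rw [hgΔ z]; push_cast; rfl) (creation_mem k m)
    (fun z => by rw [magLaplacian_creation (ν := nu s)]; push_cast; rfl) ?_
  · rw [inner_psiLp, gaussPair_congr h1, h2, mul_zero]
  · intro h
    exact hkn (by exact_mod_cast (mul_right_cancel₀ hν.ne' h).symm)

theorem exists_hasSum_of_hasSum (hs0 : 0 < s) (hs1 : s < 1) {n : ℕ} (k : ℕ) {c : ℕ → ℂ}
    {F : Lp ℂ 2 (muS s)} (hF : HasSum (fun m => c m • psiLp hs0 hs1 n m) F) :
    ∃ G, HasSum (fun m => c m • psiLp hs0 hs1 k m) G :=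
  (summable_psiLp_iff hs0 hs1 k c).mpr ((summable_psiLp_iff hs0 hs1 n c).mp hF.summable)

/-- A convergent series of `ψ_{m,n}` has a representative in `𝒳_{n,s}`: it is the transform `𝒲_n^s`
of the series of `ψ_{m,0}` with the same coefficients. -/
theorem mem_XPoly_of_hasSum (hs0 : 0 < s) (hs1 : s < 1) {n : ℕ} {c : ℕ → ℂ}
    {F : Lp ℂ 2 (muS s)} (hF : HasSum (fun m => c m • psiLp hs0 hs1 n m) F) : F ∈ XPoly s n := by
  obtain ⟨G, hG⟩ := exists_hasSum_of_hasSum hs0 hs1 0 hF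
  have h := transformW_ae_eq_of_hasSum hs0 hs1 n hG hF
  exact ⟨_, transformW_mem_polySpace hs0 hs1 n (Lp.memLp G) ((memLp_congr_ae h).mp (Lp.memLp F)), h⟩

/-- `𝒳_{n,s}` is the orthogonal complement of the `ψ_{m,k}` with `k ≠ n`. -/
theorem mem_XPoly_iff (hs0 : 0 < s) (hs1 : s < 1) {n : ℕ} {F : Lp ℂ 2 (muS s)} :
    F ∈ XPoly s n ↔ ∀ k m, k ≠ n → inner ℂ (psiLp hs0 hs1 k m) F = 0 :=
  ⟨fun hF _ m hk => inner_psiLp_of_mem_XPoly hs0 hs1 hk m hF,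
    fun h => mem_XPoly_of_hasSum hs0 hs1 (hasSum_psiLp hs0 hs1 h)⟩

theorem hasSum_of_mem_XPoly (hs0 : 0 < s) (hs1 : s < 1) {n : ℕ} {F : Lp ℂ 2 (muS s)}
    (hF : F ∈ XPoly s n) :
    HasSum (fun m => inner ℂ (psiLp hs0 hs1 n m) F • psiLp hs0 hs1 n m) F :=
  hasSum_psiLp hs0 hs1 ((mem_XPoly_iff hs0 hs1).mp hF)

theorem psiLp_mem_XPoly (hs0 : 0 < s) (hs1 : s < 1) (n m : ℕ) : psiLp hs0 hs1 n m ∈ XPoly s n :=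
  ⟨_, psi_mem_polySpace hs0 hs1 m n, coeFn_psiLp hs0 hs1 n m⟩

theorem completeSpace_XPoly (hs0 : 0 < s) (hs1 : s < 1) (n : ℕ) : CompleteSpace (XPoly s n) := by
  have e : (XPoly s n : Set (Lp ℂ 2 (muS s))) =
      ⋂ (k : ℕ) (m : ℕ) (_ : k ≠ n), {F | inner ℂ (psiLp hs0 hs1 k m) F = 0} := by
    ext F
    simp only [SetLike.mem_coe, mem_XPoly_iff hs0 hs1, Set.mem_iInter, Set.mem_ofPred_eq]
  have hc : IsClosed (XPoly s n : Set (Lp ℂ 2 (muS s))) := by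
    rw [e]
    refine isClosed_iInter fun k => isClosed_iInter fun m => isClosed_iInter fun _ =>
      isClosed_eq ?_ continuous_const
    fun_prop
  exact hc.completeSpace_coe

theorem exists_hilbertBasis_XPoly (hs0 : 0 < s) (hs1 : s < 1) (n : ℕ) :
    ∃ b : HilbertBasis ℕ ℂ (XPoly s n), ∀ m, (b m : Lp ℂ 2 (muS s)) = psiLp hs0 hs1 n m := by
  have := completeSpace_XPoly hs0 hs1 n
  set v : ℕ → XPoly s n := fun m => ⟨psiLp hs0 hs1 n m, psiLp_mem_XPoly hs0 hs1 n m⟩ with hv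
  have ho : Orthonormal ℂ v := by
    rw [orthonormal_iff_ite]
    intro m l
    rw [Submodule.coe_inner, hv, inner_psiLp_psiLp]
    simp
  refine ⟨HilbertBasis.mkOfOrthogonalEqBot ho ?_, fun m => by
    rw [HilbertBasis.coe_mkOfOrthogonalEqBot]⟩
  rw [Submodule.eq_bot_iff]
  intro F hF
  have h (m : ℕ) : inner ℂ (psiLp hs0 hs1 n m) (F : Lp ℂ 2 (muS s)) = 0 :=
    (Submodule.mem_orthogonal _ _).mp hF _ (Submodule.subset_span ⟨m, rfl⟩)
  have hs := hasSum_of_mem_XPoly hs0 hs1 F.2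
  simp only [h, zero_smul] at hs
  exact Subtype.ext (hs.unique hasSum_zero)

/-- `𝒳_s = 𝒳_{0,s}`. An element of `𝒳_{0,s}`, which is a priori only annihilated by the magnetic
Laplacian, is entire because it is fixed by `𝒲_0^s`. -/
theorem XHol_eq_XPoly_zero (hs0 : 0 < s) (hs1 : s < 1) : XHol s = XPoly s 0 := by
  refine le_antisymm ?_ fun F hF => ?_
  · rintro F ⟨f, ⟨hd, hf⟩, hFf⟩
    have hd' : Differentiable ℂ (mulExp (alpha s) f) := fun z =>
      (hasDerivAt_cexp_mul_sq (alpha s : ℝ) z).differentiableAt.mul (hd z)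
    refine ⟨f, ⟨mulExp (alpha s) f, ⟨hd'.contDiff.restrict_scalars ℝ, memLp_mulExp hf, fun z => ?_⟩,
      mulExp_neg_mulExp _ f⟩, hFf⟩
    have h0 : dzbar (mulExp (alpha s) f) = 0 :=
      funext fun w => (HasDerivAt.hasWirtinger (hd' w).hasDerivAt).dzbar
    simp [magLaplacian, h0, dz]
  · have hs := hasSum_of_mem_XPoly hs0 hs1 hF
    have h := transformW_ae_eq_of_hasSum hs0 hs1 0 hs hs
    exact ⟨_, transformW_mem_holSpace hs0 hs1 (Lp.memLp F)
      ((memLp_congr_ae h).mp (Lp.memLp F)), h⟩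

theorem transformW_mem_polySpace_of_mem_holSpace (hs0 : 0 < s) (hs1 : s < 1) (n : ℕ)
    (hf : f ∈ holSpace s) : transformW s n f ∈ polySpace s n := by
  have hF : hf.2.toLp f ∈ XPoly s 0 := by
    rw [← XHol_eq_XPoly_zero hs0 hs1]
    exact ⟨f, hf, hf.2.coeFn_toLp⟩
  have hs := hasSum_of_mem_XPoly hs0 hs1 hF
  obtain ⟨G, hG⟩ := exists_hasSum_of_hasSum hs0 hs1 n hs
  have h := transformW_ae_eq_of_hasSum hs0 hs1 n hs hG
  rw [transformW_congr_ae n hf.2.coeFn_toLp] at h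
  exact transformW_mem_polySpace hs0 hs1 n hf.2 ((memLp_congr_ae h).mp (Lp.memLp G))

theorem exists_unitary_transformW (hs0 : 0 < s) (hs1 : s < 1) (n : ℕ) :
    ∃ U : XHol s ≃ₗᵢ[ℂ] XPoly s n, ∀ F : XHol s,
      ((U F : Lp ℂ 2 (muS s)) : ℂ → ℂ) =ᵐ[muS s] transformW s n (F : Lp ℂ 2 (muS s)) := by
  obtain ⟨b, hb⟩ := exists_hilbertBasis_XPoly hs0 hs1 n
  obtain ⟨b₀, hb₀⟩ : ∃ b : HilbertBasis ℕ ℂ (XHol s),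
      ∀ m, (b m : Lp ℂ 2 (muS s)) = psiLp hs0 hs1 0 m := by
    rw [XHol_eq_XPoly_zero hs0 hs1]
    exact exists_hilbertBasis_XPoly hs0 hs1 0
  refine ⟨b₀.repr.trans b.repr.symm, fun F => ?_⟩
  refine transformW_ae_eq_of_hasSum hs0 hs1 n (c := b₀.repr F) ?_ ?_
  · have h := (b₀.hasSum_repr F).mapL (XHol s).subtypeL
    simpa [hb₀] using h
  · have h := (b.hasSum_repr_symm (b₀.repr F)).mapL (XPoly s n).subtypeL
    simpa [hb] using h

theorem isHilbertSum_XPoly (hs0 : 0 < s) (hs1 : s < 1) :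
    IsHilbertSum ℂ (fun n : ℕ => XPoly s n) (fun n : ℕ => (XPoly s n).subtypeₗᵢ) := by
  have (n : ℕ) := completeSpace_XPoly hs0 hs1 n
  refine IsHilbertSum.mkInternal _ ?_ ?_
  · intro n k hnk F G
    have h := (hasSum_of_mem_XPoly hs0 hs1 F.2).mapL (innerSL ℂ (G : Lp ℂ 2 (muS s)))
    have h0 (m : ℕ) : inner ℂ (G : Lp ℂ 2 (muS s)) (psiLp hs0 hs1 n m) = 0 := by
      rw [← inner_conj_symm, inner_psiLp_of_mem_XPoly hs0 hs1 hnk m G.2, map_zero]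
    simp only [map_smul, innerSL_apply_apply, h0, smul_zero] at h
    rw [← inner_conj_symm]
    simp [h.unique hasSum_zero]
  · obtain ⟨B, hB⟩ := exists_hilbertBasis_psiLp hs0 hs1
    rw [← B.dense_span]
    refine Submodule.topologicalClosure_mono (Submodule.span_le.mpr ?_)
    rintro _ ⟨p, rfl⟩
    rw [hB p]
    exact Submodule.mem_iSup_of_mem p.1 (psiLp_mem_XPoly hs0 hs1 p.1 p.2)

end

end HolHermite

end

theorem mainTheorem2 (s : ℝ) (hs0 : 0 < s) (hs1 : s < 1) :
    (∀ n : ℕ,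
      (∀ f ∈ HolHermite.holSpace s,
        (∀ z : ℂ, Integrable (HolHermite.transformIntegrand s n f z) volume) ∧
          HolHermite.transformW s n f ∈ HolHermite.polySpace s n) ∧
      ∃ U : HolHermite.XHol s ≃ₗᵢ[ℂ] HolHermite.XPoly s n,
        ∀ F : HolHermite.XHol s,
          ((U F : Lp ℂ 2 (HolHermite.muS s)) : ℂ → ℂ) =ᵐ[HolHermite.muS s]
            HolHermite.transformW s n ((F : Lp ℂ 2 (HolHermite.muS s)) : ℂ → ℂ)) ∧
    (∀ n : ℕ,
      (∀ m : ℕ, HolHermite.psi s m n ∈ HolHermite.polySpace s n) ∧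
      ∃ b : HilbertBasis ℕ ℂ (HolHermite.XPoly s n),
        ∀ m : ℕ, ((b m : Lp ℂ 2 (HolHermite.muS s)) : ℂ → ℂ) =ᵐ[HolHermite.muS s]
          HolHermite.psi s m n) ∧
    IsHilbertSum ℂ (fun n : ℕ => HolHermite.XPoly s n)
      (fun n : ℕ => (HolHermite.XPoly s n).subtypeₗᵢ) := by
  refine ⟨fun n => ⟨fun f hf => ⟨fun z => ?_, ?_⟩, ?_⟩, fun n => ⟨fun m => ?_, ?_⟩, ?_⟩
  · exact HolHermite.integrable_transformIntegrand hs0 hs1 n hf.2 z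
  · exact HolHermite.transformW_mem_polySpace_of_mem_holSpace hs0 hs1 n hf
  · exact HolHermite.exists_unitary_transformW hs0 hs1 n
  · exact HolHermite.psi_mem_polySpace hs0 hs1 m n
  · obtain ⟨b, hb⟩ := HolHermite.exists_hilbertBasis_XPoly hs0 hs1 n
    exact ⟨b, fun m => hb m ▸ HolHermite.coeFn_psiLp hs0 hs1 n m⟩
  · exact HolHermite.isHilbertSum_XPoly hs0 hs1
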